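/- Let $L>0$, let $\mathbb T=[-L,L]$ be the one-dimensional torus (periodic boundary conditions), let $U=[-\tfrac12,\tfrac12]^{\mathbb N}$ with its product $\sigma$-algebra, let $s\ge 1$ be real and $\alpha\in\mathbb R\setminus\{0\}$ (both the defocusing case $\alpha>0$ and the focusing case $\alpha<0$ are covered). Write $\|f\|_{H^s}^2=\sum_{n\in\mathbb Z}(1+(\pi n/L)^2)^s|\hat f_n|^2$. Let $$V(\boldsymbol\xi,x)=v_0(x)+\sum_{j=1}^\infty\sqrt{\lambda_j}\,\xi_j v_j(x),\qquad \boldsymbol\xi\in U,$$ with real-valued $v_0,v_j\in H^s(\mathbb T)$ and $\lambda_1>\lambda_2>\cdots>0$, where the series converges in $L^2(\mathbb T)$ for every $\boldsymbol\xi\in U$ and $V\in L^\infty(U;H^s(\mathbb T))$, i.e. $V:U\to H^s(\mathbb T)$ is strongly measurable and $\sup_{\boldsymbol\xi\in U}\|V(\boldsymbol\xi)\|_{H^s}<\infty$. Let $\psi_{in}\in H^s(\mathbb T)$ be complex-valued and independent of $\boldsymbol\xi$. Consider $$i\partial_t\psi=-\tfrac12\partial_x^2\psi+V(\boldsymbol\xi,x)\psi+\alpha|\psi|^2\psi,\quad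 x\in\mathbb T,\ t>0,\qquad \psi(0,\boldsymbol\xi,x)=\psi_{in}(x).\tag{1}$$ Then: 1. For each $\boldsymbol\xi\in U$ the equation in (1) is globally well-posed in $H^1(\mathbb T)$: every initial datum $\varphi\in H^1(\mathbb T)$ has a solution in $C([0,\infty);H^1(\mathbb T))$ (the equation being understood in the sense of periodic distributions in $x$ for every $t>0$); for every $T>0$ it is the only solution in $C([0,T];H^1(\mathbb T))$; and the map from $\varphi$ to the solution is continuous from $H^1(\mathbb T)$ to $C([0,T];H^1(\mathbb T))$. 2. The solution $\psi(t,\boldsymbol\xi,\cdot)$ of (1) with initial datum $\psi_{in}$ is uniformly bounded in $H^1(\mathbb T)$: $\sup_{t\ge0,\ \boldsymbol\xi\in U}\|\psi(t,\boldsymbol\xi)\|_{H^1}<\infty$. 3. $\psi(t,\boldsymbol\xi)\in H^s(\mathbb T)$ for all $t\ge0$ and $\boldsymbol\xi\in U$, and for every $0<T<\infty$ we have $\psi\in L^\infty((0,T)\times U;H^s(\mathbb T))$, i.e. $\psi:(0,T)\times U\to H^s(\mathbb T)$ is strongly measurable and $\sup_{t\in(0,T),\ \boldsymbol\xi\in U}\|\psi(t,\boldsymbol\xi)\|_{H^s}<\infty$.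 -/

import Mathlib

open MeasureTheory Set Filter Topology AddCircle

noncomputable section

/-- The torus `𝕋 = [-L, L]` with periodic boundary conditions. -/
abbrev Torus (L : ℝ) : Type := AddCircle (2 * L)

/-- The space `L²(𝕋)` of complex-valued functions (for the normalized Lebesgue measure). -/
abbrev L2Torus (L : ℝ) [Fact (0 < 2 * L)] : Type :=
  Lp ℂ 2 (haarAddCircle : Measure (Torus L))

/-- The frequency `π n / L` of the `n`-th character `x ↦ exp (i π n x / L)` of `𝕋`. -/
def freq (L : ℝ) (n : ℤ) : ℝ := Real.pi * n / L

/-- The sequence `n ↦ (1 + (π n / L) ^ 2) ^ (s / 2) * f̂(n)`. -/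
def weightedCoeff (L s : ℝ) [Fact (0 < 2 * L)] (f : L2Torus L) (n : ℤ) : ℂ :=
  (((1 + freq L n ^ 2) ^ (s / 2) : ℝ) : ℂ) * fourierCoeff (f : Torus L → ℂ) n

theorem weightedCoeff_add (L s : ℝ) [Fact (0 < 2 * L)] (f g : L2Torus L) :
    weightedCoeff L s (f + g) = weightedCoeff L s f + weightedCoeff L s g := by
  funext n
  simp only [weightedCoeff, Pi.add_apply, ← fourierBasis_repr, map_add, lp.coeFn_add, mul_add]

theorem weightedCoeff_smul (L s : ℝ) [Fact (0 < 2 * L)] (c : ℂ) (f : L2Torus L) :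
    weightedCoeff L s (c • f) = c • weightedCoeff L s f := by
  funext n
  simp only [weightedCoeff, Pi.smul_apply, ← fourierBasis_repr, map_smul, lp.coeFn_smul,
    smul_eq_mul]
  ring

theorem weightedCoeff_zero (L s : ℝ) [Fact (0 < 2 * L)] :
    weightedCoeff L s (0 : L2Torus L) = 0 := by
  have h := weightedCoeff_smul L s 0 (0 : L2Torus L)
  simpa using h

/-- The functions `f ∈ L²(𝕋)` with `∑ n, (1 + (π n / L) ^ 2) ^ s * |f̂(n)| ^ 2 < ∞`. -/
def sobolevSubmodule (L s : ℝ) [Fact (0 < 2 * L)] : Submodule ℂ (L2Torus L) where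
  carrier := {f | Memℓp (weightedCoeff L s f) 2}
  zero_mem' := by
    simp only [mem_ofPred_eq, weightedCoeff_zero]
    exact zero_memℓp
  add_mem' := by
    intro f g hf hg
    simp only [mem_ofPred_eq, weightedCoeff_add] at *
    exact hf.add hg
  smul_mem' := by
    intro c f hf
    simp only [mem_ofPred_eq, weightedCoeff_smul] at *
    exact hf.const_smul c

/-- The Sobolev space `H^s(𝕋)`, `s ≥ 0`. -/
def Hs (L s : ℝ) [Fact (0 < 2 * L)] : Type := sobolevSubmodule L s

namespace Hs

variable {L s : ℝ} [Fact (0 < 2 * L)]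

instance : AddCommGroup (Hs L s) := inferInstanceAs (AddCommGroup (sobolevSubmodule L s))

instance : Module ℂ (Hs L s) := inferInstanceAs (Module ℂ (sobolevSubmodule L s))

/-- An element of `H^s(𝕋)` as an element of `L²(𝕋)`. -/
def toL2 : Hs L s →ₗ[ℂ] L2Torus L := (sobolevSubmodule L s).subtype

/-- The map `f ↦ ((1 + (π n / L) ^ 2) ^ (s / 2) * f̂(n))ₙ` from `H^s(𝕋)` to `ℓ²(ℤ)`. -/
def toSeq : Hs L s →ₗ[ℂ] lp (fun _ : ℤ => ℂ) 2 where
  toFun f := ⟨weightedCoeff L s f.toL2, f.2⟩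
  map_add' f g := by
    apply Subtype.ext
    simp only [map_add, weightedCoeff_add]
    rfl
  map_smul' c f := by
    apply Subtype.ext
    simp only [map_smul, weightedCoeff_smul]
    rfl

theorem toSeq_injective : Function.Injective (toSeq : Hs L s →ₗ[ℂ] _) := by
  intro f g h
  apply Subtype.ext
  apply (fourierBasis (T := 2 * L)).repr.injective
  apply lp.ext
  funext n
  have h1 : weightedCoeff L s f.toL2 n = weightedCoeff L s g.toL2 n :=
    congrFun (congrArg Subtype.val h) n
  have hw : (((1 + freq L n ^ 2) ^ (s / 2) : ℝ) : ℂ) ≠ 0 := by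
    have : (0 : ℝ) < (1 + freq L n ^ 2) ^ (s / 2) := by positivity
    exact_mod_cast this.ne'
  rw [fourierBasis_repr, fourierBasis_repr]
  exact mul_left_cancel₀ hw h1

/-- The norm of `H^s(𝕋)`: `‖f‖ ^ 2 = ∑ n, (1 + (π n / L) ^ 2) ^ s * |f̂(n)| ^ 2`. -/
instance : NormedAddCommGroup (Hs L s) :=
  NormedAddCommGroup.induced (Hs L s) (lp (fun _ : ℤ => ℂ) 2) toSeq toSeq_injective

instance : NormedSpace ℂ (Hs L s) :=
  NormedSpace.induced ℂ (Hs L s) (lp (fun _ : ℤ => ℂ) 2) toSeq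

theorem norm_sq_eq (f : Hs L s) :
    ‖f‖ ^ 2 = ∑' n : ℤ, (1 + freq L n ^ 2) ^ s * ‖fourierCoeff (f.toL2 : Torus L → ℂ) n‖ ^ 2 := by
  have h : ‖f‖ = ‖toSeq f‖ := rfl
  have h2 := lp.norm_rpow_eq_tsum (p := 2) (by norm_num) (toSeq f)
  simp only [ENNReal.toReal_ofNat, Real.rpow_ofNat] at h2
  rw [h, h2]
  congr 1
  funext n
  change ‖weightedCoeff L s f.toL2 n‖ ^ 2 = _
  have hp : (0 : ℝ) ≤ 1 + freq L n ^ 2 := by positivity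
  rw [weightedCoeff, norm_mul, mul_pow, Complex.norm_real, Real.norm_of_nonneg (by positivity),
    ← Real.rpow_natCast, ← Real.rpow_mul hp]
  norm_num

theorem mem_of_le {r : ℝ} (h : r ≤ s) {f : L2Torus L} (hf : f ∈ sobolevSubmodule L s) :
    f ∈ sobolevSubmodule L r := by
  have h0 : (0 : ℝ) < (2 : ENNReal).toReal := by norm_num
  have hf' : Memℓp (weightedCoeff L s f) 2 := hf
  have hs := (memℓp_gen_iff h0).1 hf'
  change Memℓp (weightedCoeff L r f) 2
  refine (memℓp_gen_iff h0).2 (hs.of_nonneg_of_le (fun n => by positivity) fun n => ?_)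
  have h1 : (1 : ℝ) ≤ 1 + freq L n ^ 2 := by nlinarith [sq_nonneg (freq L n)]
  refine Real.rpow_le_rpow (norm_nonneg _) ?_ h0.le
  rw [weightedCoeff, weightedCoeff, norm_mul, norm_mul, Complex.norm_real, Complex.norm_real,
    Real.norm_of_nonneg (by positivity), Real.norm_of_nonneg (by positivity)]
  gcongr

/-- The inclusion `H^s(𝕋) ⊆ H^r(𝕋)` for `r ≤ s`. -/
def incl {r : ℝ} (h : r ≤ s) (f : Hs L s) : Hs L r := ⟨f.toL2, mem_of_le h f.2⟩

/-- The function (up to a.e. equality) on `𝕋` given by an element of `H^s(𝕋)`. -/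
def toFun (f : Hs L s) : Torus L → ℂ := f.toL2

/-- Real-valued elements of `H^s(𝕋)`. -/
def IsReal (f : Hs L s) : Prop := ∀ᵐ x ∂(haarAddCircle : Measure (Torus L)), (f.toFun x).im = 0

end Hs

/-- The parameter space `U = [-1/2, 1/2]^ℕ`, with the product σ-algebra. -/
abbrev ParamSpace : Type := ℕ → Icc (-(1 / 2) : ℝ) (1 / 2)

/-- Membership in the Bochner space `L^∞(X; E)` with the norm `sup_x ‖f x‖_E`. -/
def MemBochnerLinfty {X E : Type*} [MeasurableSpace X] [NormedAddCommGroup E] (f : X → E) : Prop :=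
  StronglyMeasurable f ∧ ∃ C : ℝ, ∀ x, ‖f x‖ ≤ C

/-- `V(ξ) = v₀ + ∑ j, √λⱼ ξⱼ vⱼ` (convergence in `L²(𝕋)` for every `ξ ∈ U`) is a random potential
of Karhunen–Loève form with real-valued components and strengths `λ₀ > λ₁ > ⋯ > 0`, and
`V ∈ L^∞(U; H^s(𝕋))`. -/
structure IsRandomPotential {L s : ℝ} [Fact (0 < 2 * L)] (v₀ : Hs L s) (v : ℕ → Hs L s)
    (lam : ℕ → ℝ) (V : ParamSpace → Hs L s) : Prop where
  real_zero : v₀.IsReal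
  real : ∀ j, (v j).IsReal
  pos : ∀ j, 0 < lam j
  anti : StrictAnti lam
  series : ∀ ξ : ParamSpace, Tendsto
    (fun m : ℕ => (v₀ + ∑ j ∈ Finset.range m, ((√(lam j) * (ξ j : ℝ) : ℝ) : ℂ) • v j).toL2)
    atTop (𝓝 (V ξ).toL2)
  bounded : MemBochnerLinfty V

/-- The point `(ξ₀, …, ξₘ₋₁, 0, 0, …)` of `U`. -/
def ParamSpace.trunc (m : ℕ) (ξ : ParamSpace) : ParamSpace :=
  fun j => if j < m then ξ j else ⟨0, by norm_num, by norm_num⟩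

/-- The truncated potential `Vₘ(ξ) = v₀ + ∑ j < m, √λⱼ ξⱼ vⱼ` is `V(ξ₀, …, ξₘ₋₁, 0, 0, …)`; in
particular the bound `‖Vₘ‖ ≤ ‖V‖` in `L^∞(U; H^s(𝕋))` always holds. -/
theorem IsRandomPotential.truncation_eq {L s : ℝ} [Fact (0 < 2 * L)] {v₀ : Hs L s}
    {v : ℕ → Hs L s} {lam : ℕ → ℝ} {V : ParamSpace → Hs L s} (h : IsRandomPotential v₀ v lam V)
    (m : ℕ) (ξ : ParamSpace) :
    v₀ + ∑ j ∈ Finset.range m, ((√(lam j) * (ξ j : ℝ) : ℝ) : ℂ) • v j =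
      V (ParamSpace.trunc m ξ) := by
  have key : ∀ k, m ≤ k →
      ∑ j ∈ Finset.range k, ((√(lam j) * (ParamSpace.trunc m ξ j : ℝ) : ℝ) : ℂ) • v j =
        ∑ j ∈ Finset.range m, ((√(lam j) * (ξ j : ℝ) : ℝ) : ℂ) • v j := by
    intro k hk
    rw [← Finset.sum_subset (Finset.range_subset_range.2 hk)]
    · refine Finset.sum_congr rfl fun j hj => ?_
      rw [ParamSpace.trunc, if_pos (Finset.mem_range.1 hj)]
    · intro j _ hj
      rw [ParamSpace.trunc, if_neg (fun h' => hj (Finset.mem_range.2 h'))]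
      simp
  have h1 := h.series (ParamSpace.trunc m ξ)
  have h2 := h1.congr' (f₂ := fun _ => (v₀ + ∑ j ∈ Finset.range m,
      ((√(lam j) * (ξ j : ℝ) : ℝ) : ℂ) • v j).toL2) (by
    filter_upwards [eventually_ge_atTop m] with k hk
    rw [key k hk])
  exact Subtype.ext (tendsto_nhds_unique tendsto_const_nhds h2)

/-- `u ∈ C([0, T]; H¹(𝕋))`, `u(0) = φ`, and
`i ∂ₜ u = -(1/2) ∂ₓ² u + W u + α |u|² u` on `(0, T) × 𝕋` in the sense of (periodic) distributions:
tested against each character of `𝕋`, for each `t`. -/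
def IsNLSSolutionOn {L s : ℝ} [Fact (0 < 2 * L)] (W : Hs L s) (α : ℝ) (φ : Hs L 1) (T : ℝ)
    (u : ℝ → Hs L 1) : Prop :=
  ContinuousOn u (Icc 0 T) ∧ u 0 = φ ∧
  ∀ t ∈ Ioo 0 T, ∀ n : ℤ, ∃ d : ℂ,
    HasDerivAt (fun τ => fourierCoeff (u τ).toFun n) d t ∧
    Complex.I * d =
      (1 / 2 : ℂ) * (freq L n : ℂ) ^ 2 * fourierCoeff (u t).toFun n +
        fourierCoeff (fun x => W.toFun x * (u t).toFun x
          + (α : ℂ) * (‖(u t).toFun x‖ : ℂ) ^ 2 * (u t).toFun x) n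

/-- A solution in `C([0, ∞); H¹(𝕋))`. -/
def IsNLSGlobalSolution {L s : ℝ} [Fact (0 < 2 * L)] (W : Hs L s) (α : ℝ) (φ : Hs L 1)
    (u : ℝ → Hs L 1) : Prop :=
  ∀ T > 0, IsNLSSolutionOn W α φ T u

/-- Global well-posedness in `H¹(𝕋)` of `i ∂ₜ u = -(1/2) ∂ₓ² u + W u + α |u|² u`: every initial
datum `φ ∈ H¹(𝕋)` has a solution `Φ φ ∈ C([0, ∞); H¹(𝕋))`, it is the only solution in
`C([0, T]; H¹(𝕋))` for each `T > 0`, and `φ ↦ Φ φ` is continuous from `H¹(𝕋)` to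
`C([0, T]; H¹(𝕋))` for each `T > 0`. -/
def NLSGloballyWellPosed {L s : ℝ} [Fact (0 < 2 * L)] (W : Hs L s) (α : ℝ) : Prop :=
  ∃ Φ : Hs L 1 → ℝ → Hs L 1,
    (∀ φ, IsNLSGlobalSolution W α φ (Φ φ)) ∧
    (∀ φ, ∀ T > 0, ∀ u, IsNLSSolutionOn W α φ T u → EqOn u (Φ φ) (Icc 0 T)) ∧
    (∀ φ, ∀ T > 0, TendstoUniformlyOn Φ (Φ φ) (𝓝 φ) (Icc 0 T))

end

noncomputable section

set_option linter.unusedSectionVars false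

open scoped ComplexConjugate ComplexOrder NNReal ENNReal

/-! ## Fourier coefficients and the weighted `ℓ²` model of `H^s` -/

/-! Everything takes place on the Fourier side, where `Hs` is a weighted `ℓ²(ℤ)`. For `s ≥ 1` the
inverse weights are square summable, so Fourier coefficients lie in `ℓ¹` (`wiener_le`) and `H^s` is
an algebra under pointwise multiplication with the tame estimate `norm_mul_le_tame`. In the
interaction picture `v t = free (-t) (u t)` the unbounded operator disappears: `v` solves an ODE
whose right-hand side `field` is Lipschitz on balls uniformly in `t`, because `free` is isometric.
Picard–Lindelöf gives solutions, an a priori bound makes them global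
(`exists_global_isODESolution`), and Gronwall gives uniqueness and Lipschitz dependence on datum and
potential.

The `H¹` bound comes from conservation of mass and energy. The energy is not visibly differentiable
along an `H¹` solution, so `energy_conservation` differentiates it along finite Fourier projections:
the Hamiltonian part cancels and the remainder tends to zero uniformly on compact time intervals. In
the focusing case the quartic term has the bad sign, but in dimension one the Wiener norm is at most
`ε` times the `H¹` norm plus a multiple of the conserved `L²` norm (`exists_wiener_le`), so the term
can be absorbed (`exists_h1_bound`). The potential enters only through its reality and a bound on
its norm, hence the uniformity in time and in `ξ`.

In `H^s`, the tame estimate makes the nonlinearity grow linearly as soon as the Wiener norm, hence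
the `H¹` norm, is bounded; Gronwall then gives an exponential bound (`exists_hs_bound`). So the ODE
is solved directly in `H^s` and the solution is included into `H¹`. Conversely every distributional
solution solves the ODE (`isODESolution_of_isNLSSolutionOn`), which gives uniqueness in the stated
class. Measurability follows from continuity in time and in the potential. -/

/-- The weight `(1 + (π n / L) ^ 2) ^ (s / 2)`. -/
def sobolevWeight (L s : ℝ) (n : ℤ) : ℝ := (1 + freq L n ^ 2) ^ (s / 2)

theorem one_le_one_add_freq_sq (L : ℝ) (n : ℤ) : 1 ≤ 1 + freq L n ^ 2 := by
  nlinarith [sq_nonneg (freq L n)]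

theorem sobolevWeight_pos (L s : ℝ) (n : ℤ) : 0 < sobolevWeight L s n :=
  Real.rpow_pos_of_pos (lt_of_lt_of_le one_pos (one_le_one_add_freq_sq L n)) _

theorem sobolevWeight_mono (L : ℝ) {r s : ℝ} (h : r ≤ s) (n : ℤ) :
    sobolevWeight L r n ≤ sobolevWeight L s n :=
  Real.rpow_le_rpow_of_exponent_le (one_le_one_add_freq_sq L n) (by linarith)

theorem one_le_sobolevWeight (L : ℝ) {s : ℝ} (hs : 0 ≤ s) (n : ℤ) : 1 ≤ sobolevWeight L s n :=
  Real.one_le_rpow (one_le_one_add_freq_sq L n) (by linarith)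

theorem freq_neg (L : ℝ) (n : ℤ) : freq L (-n) = -freq L n := by
  simp [freq, neg_div]

theorem freq_add (L : ℝ) (m n : ℤ) : freq L (m + n) = freq L m + freq L n := by
  simp [freq, mul_add, add_div]

theorem sobolevWeight_neg (L s : ℝ) (n : ℤ) : sobolevWeight L s (-n) = sobolevWeight L s n := by
  simp [sobolevWeight, freq_neg]

theorem sobolevWeight_one_sq (L : ℝ) (n : ℤ) : sobolevWeight L 1 n ^ 2 = 1 + freq L n ^ 2 := by
  have h : (0 : ℝ) ≤ 1 + freq L n ^ 2 := by positivity
  rw [sobolevWeight, ← Real.rpow_natCast, ← Real.rpow_mul h]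
  norm_num

/-- The larger frequency dominates: if `|b| ≤ |a|` then `1 + (a + b)² ≤ 4 (1 + a²)`, and the power
`s / 2` turns `4` into `2 ^ s`. This distributes the weight over the two factors of a product. -/
theorem sobolevWeight_add_le (L : ℝ) {s : ℝ} (hs : 0 ≤ s) (m n : ℤ) :
    sobolevWeight L s (m + n) ≤ 2 ^ s * (sobolevWeight L s m + sobolevWeight L s n) := by
  wlog h : freq L n ^ 2 ≤ freq L m ^ 2 generalizing m n
  · rw [add_comm m n, add_comm (sobolevWeight L s m)]
    exact this n m (le_of_not_ge h)
  have h1 : 1 + freq L (m + n) ^ 2 ≤ 2 ^ (2 : ℝ) * (1 + freq L m ^ 2) := by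
    rw [freq_add, Real.rpow_two]
    nlinarith [sq_nonneg (freq L m - freq L n)]
  calc sobolevWeight L s (m + n) ≤ (2 ^ (2 : ℝ) * (1 + freq L m ^ 2)) ^ (s / 2) :=
        Real.rpow_le_rpow (by positivity) h1 (by linarith)
    _ = 2 ^ s * sobolevWeight L s m := by
        rw [Real.mul_rpow (by positivity) (by positivity), ← Real.rpow_mul (by norm_num),
          sobolevWeight]
        congr 2
        ring
    _ ≤ _ := by
        gcongr
        linarith [sobolevWeight_pos L s n]

namespace Hs

variable {L s : ℝ} [Fact (0 < 2 * L)]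

/-- The `n`-th Fourier coefficient of an element of `H^s`. -/
def coeff (f : Hs L s) (n : ℤ) : ℂ := fourierCoeff (f.toL2 : Torus L → ℂ) n

theorem coeff_eq_repr (f : Hs L s) (n : ℤ) : coeff f n = fourierBasis.repr f.toL2 n :=
  (fourierBasis_repr _ _).symm

@[simp] theorem coeff_add (f g : Hs L s) (n : ℤ) : coeff (f + g) n = coeff f n + coeff g n := by
  simp [coeff_eq_repr]

@[simp] theorem coeff_sub (f g : Hs L s) (n : ℤ) : coeff (f - g) n = coeff f n - coeff g n := by
  simp [coeff_eq_repr]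

@[simp] theorem coeff_zero (n : ℤ) : coeff (0 : Hs L s) n = 0 := by
  simp [coeff_eq_repr]

@[simp] theorem coeff_smul (c : ℂ) (f : Hs L s) (n : ℤ) : coeff (c • f) n = c * coeff f n := by
  simp [coeff_eq_repr]

theorem ext_coeff {f g : Hs L s} (h : ∀ n, coeff f n = coeff g n) : f = g := by
  apply Subtype.ext
  apply (fourierBasis (T := 2 * L)).repr.injective
  apply lp.ext
  funext n
  simpa only [coeff_eq_repr] using! h n

theorem toSeq_apply (f : Hs L s) (n : ℤ) : toSeq f n = (sobolevWeight L s n : ℂ) * coeff f n := rfl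

theorem norm_toSeq (f : Hs L s) : ‖toSeq f‖ = ‖f‖ := rfl

theorem memlp_weight (f : Hs L s) :
    Memℓp (fun n => (sobolevWeight L s n : ℂ) * coeff f n) 2 := (toSeq f).2

theorem memlp_two_iff {E : Type*} [NormedAddCommGroup E] {a : ℤ → E} :
    Memℓp a 2 ↔ Summable fun n => ‖a n‖ ^ 2 := by
  rw [memℓp_gen_iff (by norm_num)]
  simp

section

variable [Fact (1 ≤ s)]

theorem zero_le_exponent : 0 ≤ s := zero_le_one.trans Fact.out

/-- The element of `H^s` with given Fourier coefficients. -/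
def ofCoeff (a : ℤ → ℂ) (ha : Memℓp (fun n => (sobolevWeight L s n : ℂ) * a n) 2) : Hs L s :=
  ⟨fourierBasis.repr.symm ⟨a, ha.mono' fun n => by
    rw [norm_mul, Complex.norm_real, Real.norm_of_nonneg (sobolevWeight_pos L s n).le]
    exact le_mul_of_one_le_left (norm_nonneg _) (one_le_sobolevWeight L zero_le_exponent n)⟩, by
    change Memℓp (weightedCoeff L s _) 2
    convert! ha using 2 with n
    rw [weightedCoeff, ← fourierBasis_repr, LinearIsometryEquiv.apply_symm_apply]
    rfl⟩

@[simp] theorem coeff_ofCoeff (a : ℤ → ℂ)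
    (ha : Memℓp (fun n => (sobolevWeight L s n : ℂ) * a n) 2) (n : ℤ) :
    coeff (ofCoeff a ha) n = a n := by
  rw [coeff_eq_repr]
  change fourierBasis.repr (fourierBasis.repr.symm _) n = _
  rw [LinearIsometryEquiv.apply_symm_apply]

/-- The weights never vanish, so one can divide by them. Surjectivity lets `Hs` inherit completeness
and separability from `ℓ²`. -/
theorem toSeq_surjective : Function.Surjective (toSeq : Hs L s →ₗ[ℂ] _) := by
  intro a
  have h : ∀ n, (sobolevWeight L s n : ℂ) * ((sobolevWeight L s n : ℂ)⁻¹ * a n) = a n := fun n =>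
    mul_inv_cancel_left₀ (by exact_mod_cast (sobolevWeight_pos L s n).ne') _
  refine ⟨ofCoeff (fun n => (sobolevWeight L s n : ℂ)⁻¹ * a n) ?_, ?_⟩
  · simp only [h]
    exact a.2
  · apply lp.ext
    funext n
    rw [toSeq_apply, coeff_ofCoeff, h]

/-- The isometry between `H^s` and `ℓ²`. -/
def seqEquiv : Hs L s ≃ₗᵢ[ℂ] lp (fun _ : ℤ => ℂ) 2 where
  toLinearEquiv := LinearEquiv.ofBijective toSeq ⟨toSeq_injective, toSeq_surjective⟩
  norm_map' _ := rfl

theorem seqEquiv_apply (f : Hs L s) (n : ℤ) :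
    seqEquiv f n = (sobolevWeight L s n : ℂ) * coeff f n := rfl

instance : CompleteSpace (Hs L s) :=
  (completeSpace_congr (e := (seqEquiv (L := L) (s := s)).toEquiv)
    (seqEquiv (L := L) (s := s)).isometry.isUniformEmbedding).2 inferInstance

instance : SecondCountableTopology (Hs L s) :=
  haveI : Fact ((2 : ℝ≥0∞) ≠ ∞) := ⟨by norm_num⟩
  ((seqEquiv (L := L) (s := s)).trans
    (fourierBasis (T := 2 * L)).repr.symm).toHomeomorph.isEmbedding.secondCountableTopology

/-- The sequence of weighted absolute values of the Fourier coefficients. -/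
def absSeq (f : Hs L s) : lp (fun _ : ℤ => ℝ) 2 :=
  ⟨fun n => sobolevWeight L s n * ‖coeff f n‖, by
    have h := memlp_two_iff.1 (memlp_weight f)
    refine memlp_two_iff.2 (h.congr fun n => ?_)
    simp⟩

theorem absSeq_apply (f : Hs L s) (n : ℤ) : absSeq f n = sobolevWeight L s n * ‖coeff f n‖ := rfl

theorem norm_absSeq (f : Hs L s) : ‖absSeq f‖ = ‖f‖ := by
  rw [← norm_toSeq, lp.norm_eq_tsum_rpow (by norm_num), lp.norm_eq_tsum_rpow (by norm_num)]
  congr 2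
  funext n
  rw [absSeq_apply, toSeq_apply, norm_mul, norm_mul, norm_norm, Complex.norm_real]

theorem memlp_of_le {a : ℤ → ℂ} (c : lp (fun _ : ℤ => ℝ) 2)
    (h : ∀ n, sobolevWeight L s n * ‖a n‖ ≤ c n) :
    Memℓp (fun n => (sobolevWeight L s n : ℂ) * a n) 2 :=
  c.2.mono' fun n => by
    rw [norm_mul, Complex.norm_real, Real.norm_of_nonneg (sobolevWeight_pos L s n).le]
    exact (h n).trans (le_abs_self _)

/-- Only moduli of coefficients enter the norm, so estimates reduce to finding a coefficientwise
majorant in `ℓ²`. Products and Fourier projections are bounded in this way. -/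
theorem norm_le_of_coeff_le {f : Hs L s} (c : lp (fun _ : ℤ => ℝ) 2)
    (h : ∀ n, sobolevWeight L s n * ‖coeff f n‖ ≤ c n) : ‖f‖ ≤ ‖c‖ := by
  rw [← norm_absSeq]
  refine lp.norm_mono (by norm_num) fun n => ?_
  rw [absSeq_apply, Real.norm_of_nonneg
    (mul_nonneg (sobolevWeight_pos L s n).le (norm_nonneg _))]
  exact (h n).trans (le_abs_self _)

theorem norm_le_of_norm_coeff_le {f : Hs L s} {c : ℝ} (hc : 0 ≤ c) {g : Hs L s}
    (h : ∀ n, ‖coeff f n‖ ≤ c * ‖coeff g n‖) : ‖f‖ ≤ c * ‖g‖ := by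
  have h1 : ‖f‖ ≤ ‖c • absSeq g‖ := norm_le_of_coeff_le _ fun n => by
    change _ ≤ c * (sobolevWeight L s n * ‖coeff g n‖)
    rw [mul_left_comm]
    exact mul_le_mul_of_nonneg_left (h n) (sobolevWeight_pos L s n).le
  rwa [norm_smul, Real.norm_of_nonneg hc, norm_absSeq] at h1

theorem norm_eq_of_norm_coeff_eq {f g : Hs L s}
    (h : ∀ n, ‖coeff f n‖ = ‖coeff g n‖) : ‖f‖ = ‖g‖ := by
  apply le_antisymm
  · simpa using norm_le_of_norm_coeff_le zero_le_one fun n => by rw [one_mul, h n]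
  · simpa using norm_le_of_norm_coeff_le zero_le_one fun n => by rw [one_mul, h n]

theorem weight_mul_norm_coeff_le (f : Hs L s) (n : ℤ) :
    sobolevWeight L s n * ‖coeff f n‖ ≤ ‖f‖ := by
  rw [← norm_absSeq, ← absSeq_apply]
  exact (le_abs_self _).trans (lp.norm_apply_le_norm (by norm_num) (absSeq f) n)

theorem norm_coeff_le (f : Hs L s) (n : ℤ) : ‖coeff f n‖ ≤ ‖f‖ :=
  (le_mul_of_one_le_left (norm_nonneg _) (one_le_sobolevWeight L zero_le_exponent n)).trans
    (weight_mul_norm_coeff_le f n)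

/-- The Fourier coefficients as continuous functionals. -/
def coeffL (n : ℤ) : Hs L s →L[ℂ] ℂ :=
  LinearMap.mkContinuous
    { toFun := fun f => coeff f n
      map_add' := fun f g => coeff_add f g n
      map_smul' := fun c f => coeff_smul c f n } 1
    fun f => by simpa using norm_coeff_le f n

@[simp] theorem coeffL_apply (n : ℤ) (f : Hs L s) : coeffL n f = coeff f n := rfl

theorem continuous_coeff (n : ℤ) : Continuous fun f : Hs L s => coeff f n :=
  (coeffL n).continuous

@[simp] theorem coeff_sum {ι : Type*} (F : Finset ι) (f : ι → Hs L s) (n : ℤ) :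
    coeff (∑ i ∈ F, f i) n = ∑ i ∈ F, coeff (f i) n :=
  map_sum (coeffL n) f F

theorem norm_toL2_le (f : Hs L s) : ‖f.toL2‖ ≤ ‖f‖ := by
  rw [← (fourierBasis (T := 2 * L)).repr.norm_map, ← norm_absSeq]
  refine lp.norm_mono (by norm_num) fun n => ?_
  rw [← coeff_eq_repr, absSeq_apply, norm_mul, norm_norm,
    Real.norm_of_nonneg (sobolevWeight_pos L s n).le]
  exact le_mul_of_one_le_left (norm_nonneg _) (one_le_sobolevWeight L zero_le_exponent n)

theorem norm_coeff_le_norm_toL2 (f : Hs L s) (n : ℤ) : ‖coeff f n‖ ≤ ‖f.toL2‖ := by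
  rw [← (fourierBasis (T := 2 * L)).repr.norm_map, coeff_eq_repr]
  exact lp.norm_apply_le_norm (by norm_num) _ n

/-- The inclusion `H^s ⊆ L²` as a continuous linear map. -/
def toL2L : Hs L s →L[ℂ] L2Torus L :=
  toL2.mkContinuous 1 fun f => by simpa using norm_toL2_le f

end

end Hs

/-! ## Young's inequality `ℓ¹ * ℓ² ⊆ ℓ²` -/

/-- Translation on `ℓ²(ℤ)`. -/
def lpShift (k : ℤ) (b : lp (fun _ : ℤ => ℝ) 2) : lp (fun _ : ℤ => ℝ) 2 :=
  ⟨fun n => b (n - k), Hs.memlp_two_iff.2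
    ((Equiv.subRight k).summable_iff.2 (Hs.memlp_two_iff.1 b.2))⟩

theorem norm_lpShift (k : ℤ) (b : lp (fun _ : ℤ => ℝ) 2) : ‖lpShift k b‖ = ‖b‖ := by
  rw [lp.norm_eq_tsum_rpow (by norm_num), lp.norm_eq_tsum_rpow (by norm_num)]
  congr 1
  exact (Equiv.subRight k).tsum_eq fun n => ‖b n‖ ^ ((2 : ℝ≥0∞)).toReal

theorem summable_mul_shift {a : ℤ → ℝ} (ha : Summable a) (ha0 : ∀ k, 0 ≤ a k)
    (b : lp (fun _ : ℤ => ℝ) 2) (n : ℤ) : Summable fun k => a k * b (n - k) := by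
  refine Summable.of_norm_bounded (ha.mul_right ‖b‖) fun k => ?_
  rw [norm_mul, Real.norm_of_nonneg (ha0 k)]
  exact mul_le_mul_of_nonneg_left (lp.norm_apply_le_norm (by norm_num) b _) (ha0 k)

/-- Translations are isometries of `ℓ²`, so the superposition of translates of `b` with weights `a
k` converges absolutely; its coordinates are read off by continuity of evaluation. -/
theorem exists_convolution {a : ℤ → ℝ} (ha : Summable a) (ha0 : ∀ k, 0 ≤ a k)
    (b : lp (fun _ : ℤ => ℝ) 2) :
    ∃ c : lp (fun _ : ℤ => ℝ) 2, (∀ n, c n = ∑' k, a k * b (n - k)) ∧ ‖c‖ ≤ (∑' k, a k) * ‖b‖ := by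
  have hn : ∀ k, ‖a k • lpShift k b‖ = a k * ‖b‖ := fun k => by
    rw [norm_smul, norm_lpShift, Real.norm_of_nonneg (ha0 k)]
  have hs : Summable fun k => ‖a k • lpShift k b‖ := by
    simp only [hn]
    exact ha.mul_right _
  refine ⟨∑' k, a k • lpShift k b, fun n => ?_, ?_⟩
  · have h1 := hs.of_norm.hasSum.map (lp.coeFnAddMonoidHom (fun _ : ℤ => ℝ) 2)
      (lp.uniformContinuous_coe (E := fun _ : ℤ => ℝ) (p := 2)).continuous
    have h2 := Pi.hasSum.1 h1 n
    exact h2.tsum_eq.symm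
  · refine (norm_tsum_le_tsum_norm hs).trans ?_
    simp only [hn]
    rw [tsum_mul_right]

/-- Comparison with `∑ 1 / n²`, leaving out `n = 0`. This is the one-dimensional input behind the
Sobolev embedding. -/
theorem summable_inv_sobolevWeight_sq {L : ℝ} (hL : 0 < L) {s : ℝ} (hs : 1 ≤ s) :
    Summable fun n : ℤ => ‖(sobolevWeight L s n)⁻¹‖ ^ 2 := by
  have h1 : Summable fun n : ℤ => (L / Real.pi) ^ 2 * (1 / (n : ℝ) ^ 2) :=
    (Real.summable_one_div_int_pow.2 (by norm_num)).mul_left _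
  refine h1.of_norm_bounded_eventually ?_
  rw [Filter.eventually_cofinite]
  refine (Set.finite_singleton (0 : ℤ)).subset fun n hn => ?_
  by_contra h0
  refine hn ?_
  have hn0 : (n : ℝ) ≠ 0 := by exact_mod_cast h0
  have hf : 0 < freq L n ^ 2 := by
    have : freq L n ≠ 0 := by
      rw [freq]
      have := Real.pi_pos
      positivity
    positivity
  have h2 : (L / Real.pi) ^ 2 * (1 / (n : ℝ) ^ 2) = (freq L n ^ 2)⁻¹ := by
    rw [freq]
    field_simp
  have h3 : freq L n ^ 2 ≤ sobolevWeight L s n ^ 2 := by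
    calc freq L n ^ 2 ≤ sobolevWeight L 1 n ^ 2 := by rw [sobolevWeight_one_sq]; linarith
      _ ≤ _ := pow_le_pow_left₀ (sobolevWeight_pos L 1 n).le (sobolevWeight_mono L hs n) 2
  rw [h2, Real.norm_of_nonneg (by positivity), norm_inv, inv_pow,
    Real.norm_of_nonneg (sobolevWeight_pos L s n).le]
  exact inv_anti₀ hf h3

namespace Hs

variable {L s : ℝ} [Fact (0 < 2 * L)] [Fact (1 ≤ s)]

/-! ## The Wiener norm -/

variable (L) in
theorem length_pos : 0 < L := by
  have : 0 < 2 * L := Fact.out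
  linarith

variable (L s) in
/-- The sequence of inverse weights. -/
def invWeight : lp (fun _ : ℤ => ℝ) 2 :=
  ⟨fun n => (sobolevWeight L s n)⁻¹,
    memlp_two_iff.2 (summable_inv_sobolevWeight_sq (length_pos L) Fact.out)⟩

theorem inner_absSeq (h : lp (fun _ : ℤ => ℝ) 2) (f : Hs L s) (n : ℤ) :
    inner ℝ (h n) (absSeq f n) = h n * (sobolevWeight L s n * ‖coeff f n‖) := by
  rw [absSeq_apply]
  exact mul_comm _ _

theorem inner_invWeight_absSeq (f : Hs L s) (n : ℤ) :
    inner ℝ (invWeight L s n) (absSeq f n) = ‖coeff f n‖ := by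
  rw [inner_absSeq]
  exact inv_mul_cancel_left₀ (sobolevWeight_pos L s n).ne' _

/-- Cauchy–Schwarz for the inverse weights against the weighted coefficients. -/
theorem summable_coeff (f : Hs L s) : Summable fun n => ‖coeff f n‖ :=
  (lp.summable_inner (𝕜 := ℝ) (invWeight L s) (absSeq f)).congr (inner_invWeight_absSeq f)

/-- The Wiener norm `∑ |f̂(n)|`. -/
def wiener (f : Hs L s) : ℝ := ∑' n, ‖coeff f n‖

theorem wiener_nonneg (f : Hs L s) : 0 ≤ wiener f := tsum_nonneg fun _ => norm_nonneg _

theorem wiener_eq_inner (f : Hs L s) : wiener f = inner ℝ (invWeight L s) (absSeq f) := by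
  rw [lp.inner_eq_tsum]
  simp only [inner_invWeight_absSeq]
  rfl

theorem wiener_le (f : Hs L s) : wiener f ≤ ‖invWeight L s‖ * ‖f‖ := by
  rw [wiener_eq_inner, ← norm_absSeq]
  exact real_inner_le_norm _ _

/-- Cut the inverse weights at a finite set of modes: the tail has `ℓ²` norm below `ε`, and each
remaining coefficient is at most the `L²` norm, so `C` is the number of modes kept. This replaces an
interpolation inequality. -/
theorem exists_wiener_le (L s : ℝ) [Fact (0 < 2 * L)] [Fact (1 ≤ s)] {ε : ℝ} (hε : 0 < ε) :
    ∃ C : ℝ, 0 ≤ C ∧ ∀ f : Hs L s, wiener f ≤ ε * ‖f‖ + C * ‖f.toL2‖ := by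
  have h1 := lp.hasSum_single (E := fun _ : ℤ => ℝ) (p := 2) (by norm_num) (invWeight L s)
  obtain ⟨F, hF⟩ := (Metric.tendsto_atTop.1 h1 ε hε)
  have hF := hF F le_rfl
  set P := ∑ i ∈ F, lp.single (E := fun _ : ℤ => ℝ) 2 i (invWeight L s i)
  refine ⟨F.card, by positivity, fun f => ?_⟩
  have h2 : wiener f = inner ℝ (invWeight L s - P) (absSeq f) + inner ℝ P (absSeq f) := by
    rw [wiener_eq_inner, ← inner_add_left, sub_add_cancel]
  have h3 : inner ℝ P (absSeq f) = ∑ i ∈ F, ‖coeff f i‖ := by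
    rw [sum_inner]
    refine Finset.sum_congr rfl fun i _ => ?_
    rw [lp.inner_single_left, inner_invWeight_absSeq]
  rw [h2, h3]
  gcongr
  · rw [← norm_absSeq f]
    refine (real_inner_le_norm _ _).trans ?_
    gcongr
    rw [← dist_eq_norm, dist_comm]
    exact hF.le
  · calc ∑ i ∈ F, ‖coeff f i‖ ≤ ∑ _i ∈ F, ‖f.toL2‖ :=
          Finset.sum_le_sum fun i _ => norm_coeff_le_norm_toL2 f i
      _ = _ := by simp

/-! ## The product -/

theorem summable_coeff_mul (f g : Hs L s) (n : ℤ) :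
    Summable fun k => ‖coeff f k‖ * ‖coeff g (n - k)‖ := by
  refine ((summable_coeff f).mul_right ‖g‖).of_nonneg_of_le (fun k => by positivity) fun k => ?_
  gcongr
  exact norm_coeff_le _ _

/-- The weight at `n = k + (n - k)` splits over the two factors, and each half is an `ℓ¹ * ℓ²`
convolution. The majorant itself is kept because it both defines the product and bounds it. -/
theorem exists_mul_bound (f g : Hs L s) : ∃ c : lp (fun _ : ℤ => ℝ) 2,
    (∀ n, sobolevWeight L s n * ‖∑' k, coeff f k * coeff g (n - k)‖ ≤ c n) ∧
      ‖c‖ ≤ 2 ^ s * (‖f‖ * wiener g + wiener f * ‖g‖) := by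
  obtain ⟨c₁, h1, h1'⟩ := exists_convolution (summable_coeff g) (fun _ => norm_nonneg _) (absSeq f)
  obtain ⟨c₂, h2, h2'⟩ := exists_convolution (summable_coeff f) (fun _ => norm_nonneg _) (absSeq g)
  refine ⟨(2 ^ s : ℝ) • (c₁ + c₂), fun n => ?_, ?_⟩
  · have hs1 := summable_mul_shift (summable_coeff g) (fun _ => norm_nonneg _) (absSeq f) n
    have hs2 := summable_mul_shift (summable_coeff f) (fun _ => norm_nonneg _) (absSeq g) n
    -- The reflection `k ↦ n - k` brings both convolutions to the same summation index.
    have e1 : c₁ n = ∑' k, absSeq f k * ‖coeff g (n - k)‖ := by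
      rw [h1, ← (Equiv.subLeft n).tsum_eq]
      refine tsum_congr fun k => ?_
      simp [mul_comm]
    have hs1' : Summable fun k => absSeq f k * ‖coeff g (n - k)‖ := by
      rw [← (Equiv.subLeft n).summable_iff]
      refine hs1.congr fun k => ?_
      simp [mul_comm]
    change _ ≤ 2 ^ s * (c₁ n + c₂ n)
    rw [e1, h2, ← hs1'.tsum_add hs2, ← tsum_mul_left]
    calc sobolevWeight L s n * ‖∑' k, coeff f k * coeff g (n - k)‖
        ≤ sobolevWeight L s n * ∑' k, ‖coeff f k‖ * ‖coeff g (n - k)‖ := by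
          have hs := summable_coeff_mul f g n
          gcongr
          · exact (sobolevWeight_pos L s n).le
          · refine (norm_tsum_le_tsum_norm (by simpa only [norm_mul] using hs)).trans ?_
            simp only [norm_mul]
            exact le_rfl
      _ = ∑' k, sobolevWeight L s n * (‖coeff f k‖ * ‖coeff g (n - k)‖) := tsum_mul_left.symm
      _ ≤ _ := by
          refine Summable.tsum_le_tsum (fun k => ?_) ((summable_coeff_mul f g n).mul_left _)
            ((hs1'.add hs2).mul_left _)
          have hw := sobolevWeight_add_le L (zero_le_exponent (s := s)) k (n - k)
          rw [add_sub_cancel] at hw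
          calc _ ≤ 2 ^ s * (sobolevWeight L s k + sobolevWeight L s (n - k)) *
                (‖coeff f k‖ * ‖coeff g (n - k)‖) := by gcongr
            _ = _ := by
                rw [absSeq_apply, absSeq_apply]
                ring
  · rw [norm_smul, Real.norm_of_nonneg (by positivity)]
    rw [norm_absSeq] at h1' h2'
    gcongr
    refine (norm_add_le _ _).trans (add_le_add ?_ h2')
    rw [mul_comm]
    exact h1'

instance : Mul (Hs L s) where
  mul f g := ofCoeff (fun n => ∑' k, coeff f k * coeff g (n - k))
    (memlp_of_le _ (exists_mul_bound f g).choose_spec.1)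

theorem coeff_mul (f g : Hs L s) (n : ℤ) :
    coeff (f * g) n = ∑' k, coeff f k * coeff g (n - k) :=
  coeff_ofCoeff _ _ _

theorem norm_mul_le_tame (f g : Hs L s) :
    ‖f * g‖ ≤ 2 ^ s * (‖f‖ * wiener g + wiener f * ‖g‖) := by
  obtain ⟨c, h1, h2⟩ := exists_mul_bound f g
  refine (norm_le_of_coeff_le c fun n => ?_).trans h2
  rw [coeff_mul]
  exact h1 n

variable (L s) in
/-- The constant in the algebra inequality for `H^s`. -/
def mulConst : ℝ := 2 ^ s * (2 * ‖invWeight L s‖)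

theorem mulConst_nonneg : 0 ≤ mulConst L s := by
  unfold mulConst
  positivity

theorem norm_mul_le' (f g : Hs L s) : ‖f * g‖ ≤ mulConst L s * ‖f‖ * ‖g‖ := by
  refine (norm_mul_le_tame f g).trans ?_
  calc 2 ^ s * (‖f‖ * wiener g + wiener f * ‖g‖)
      ≤ 2 ^ s * (‖f‖ * (‖invWeight L s‖ * ‖g‖) + (‖invWeight L s‖ * ‖f‖) * ‖g‖) := by
        gcongr <;> exact wiener_le _
    _ = _ := by
        rw [mulConst]
        ring

/-! ## Realization as continuous functions -/

theorem summable_coeff_smul_fourier (f : Hs L s) :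
    Summable fun n => ‖coeff f n • (fourier n : C(Torus L, ℂ))‖ := by
  simpa only [norm_smul, fourier_norm, mul_one] using summable_coeff f

/-- The continuous function given by an element of `H^s`. -/
def toC (f : Hs L s) : C(Torus L, ℂ) := ∑' n, coeff f n • fourier n

/-- The uniformly convergent Fourier series also converges in `L²`, where its sum is already known.
-/
theorem toLp_toC (f : Hs L s) :
    ContinuousMap.toLp (E := ℂ) 2 (haarAddCircle : Measure (Torus L)) ℂ (toC f) = f.toL2 := by
  have h1 := (summable_coeff_smul_fourier f).of_norm.hasSum.mapL
    (ContinuousMap.toLp (E := ℂ) 2 (haarAddCircle : Measure (Torus L)) ℂ)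
  refine h1.unique ?_
  simpa only [map_smul] using! hasSum_fourier_series_L2 f.toL2

theorem toC_ae_eq (f : Hs L s) : toC f =ᵐ[haarAddCircle] f.toFun := by
  have h := ContinuousMap.coeFn_toLp (p := 2) (𝕜 := ℂ) (haarAddCircle : Measure (Torus L)) (toC f)
  rw [toLp_toC] at h
  exact h.symm

theorem fourierCoeff_toC (f : Hs L s) (n : ℤ) : fourierCoeff (toC f) n = coeff f n :=
  congrFun (fourierCoeff_congr_ae (toC_ae_eq f)) n

/-- The ring and star axioms of `Hs` are pulled back from continuous functions through this
injection. -/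
theorem toC_injective : Function.Injective (toC : Hs L s → _) := fun f g h =>
  ext_coeff fun n => by rw [← fourierCoeff_toC, ← fourierCoeff_toC, h]

theorem norm_toC_le (f : Hs L s) : ‖toC f‖ ≤ wiener f := by
  refine (norm_tsum_le_tsum_norm (summable_coeff_smul_fourier f)).trans ?_
  simp only [norm_smul, fourier_norm, mul_one]
  exact le_rfl

theorem toC_add (f g : Hs L s) : toC (f + g) = toC f + toC g := by
  simp only [toC, coeff_add, add_smul]
  exact (summable_coeff_smul_fourier f).of_norm.tsum_add (summable_coeff_smul_fourier g).of_norm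

theorem toC_smul (c : ℂ) (f : Hs L s) : toC (c • f) = c • toC f := by
  simp only [toC, coeff_smul, mul_smul]
  exact (summable_coeff_smul_fourier f).of_norm.tsum_const_smul c

theorem toC_mul (f g : Hs L s) : toC (f * g) = toC f * toC g := by
  have hf := summable_coeff_smul_fourier f
  have hg := summable_coeff_smul_fourier g
  have hfg := summable_mul_of_summable_norm hf hg
  -- Regroups the absolutely convergent double series by total frequency: `(n, k) ↦ (k, n - k)`.
  let e : ℤ × ℤ ≃ ℤ × ℤ :=
    { toFun := fun p => (p.2, p.1 - p.2)
      invFun := fun p => (p.1 + p.2, p.1)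
      left_inv := fun p => by simp
      right_inv := fun p => by simp }
  have hfg' := e.summable_iff.2 hfg
  rw [toC, toC, toC, tsum_mul_tsum_of_summable_norm hf hg, ← e.tsum_eq]
  refine Eq.trans ?_ hfg'.tsum_prod.symm
  refine tsum_congr fun n => ?_
  have hk : Summable fun k => coeff f k * coeff g (n - k) := by
    refine Summable.of_norm ?_
    simpa only [norm_mul] using summable_coeff_mul f g n
  rw [coeff_mul, ← hk.tsum_smul_const]
  refine tsum_congr fun k => ?_
  have : (fourier n : C(Torus L, ℂ)) = fourier k * fourier (n - k) := by
    ext x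
    rw [ContinuousMap.mul_apply, ← fourier_add, add_sub_cancel]
  rw [this, ← smul_mul_smul_comm]
  rfl

/-- The complex conjugate. -/
instance : Star (Hs L s) where
  star f := ofCoeff (fun n => conj (coeff f (-n))) (memlp_of_le (L := L) (s := s)
    ⟨fun n => absSeq f (-n), memlp_two_iff.2
      ((Equiv.neg ℤ).summable_iff.2 (memlp_two_iff.1 (absSeq f).2))⟩ fun n => by
        change _ ≤ absSeq f (-n)
        rw [absSeq_apply, sobolevWeight_neg, RCLike.norm_conj])

theorem coeff_star (f : Hs L s) (n : ℤ) : coeff (star f) n = conj (coeff f (-n)) :=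
  coeff_ofCoeff _ _ _

theorem toC_star (f : Hs L s) : toC (star f) = star (toC f) := by
  have h1 := (summable_coeff_smul_fourier f).of_norm.hasSum.star
  have h2 := (Equiv.neg ℤ).hasSum_iff.2 h1
  refine Eq.trans ?_ h2.tsum_eq
  refine tsum_congr fun n => ?_
  ext x
  simp [coeff_star]

theorem norm_star' (f : Hs L s) : ‖star f‖ = ‖f‖ := by
  rw [← norm_toSeq (star f), ← norm_toSeq f, lp.norm_eq_tsum_rpow (by norm_num),
    lp.norm_eq_tsum_rpow (by norm_num)]
  congr 1
  rw [← (Equiv.neg ℤ).tsum_eq]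
  refine tsum_congr fun n => ?_
  simp [toSeq_apply, coeff_star, sobolevWeight_neg]

theorem wiener_star (f : Hs L s) : wiener (star f) = wiener f := by
  rw [wiener, wiener, ← (Equiv.neg ℤ).tsum_eq]
  refine tsum_congr fun n => ?_
  simp [coeff_star]

end Hs

namespace Hs

variable {L s : ℝ} [Fact (0 < 2 * L)] [Fact (1 ≤ s)]

/-! ## The ring structure -/

theorem memlp_single_zero (L s : ℝ) :
    Memℓp (fun n => (sobolevWeight L s n : ℂ) * if n = 0 then 1 else 0) 2 := by
  have : (fun n : ℤ => (sobolevWeight L s n : ℂ) * if n = 0 then 1 else 0) =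
      (lp.single (E := fun _ : ℤ => ℂ) 2 0 (sobolevWeight L s 0 : ℂ) : ℤ → ℂ) := by
    funext n
    by_cases h : n = 0
    · subst h
      simp
    · simp [h]
  rw [this]
  exact (lp.single (E := fun _ : ℤ => ℂ) 2 0 (sobolevWeight L s 0 : ℂ)).2

instance : One (Hs L s) where
  one := ofCoeff (fun n => if n = 0 then 1 else 0) (memlp_single_zero L s)

theorem toC_one : toC (1 : Hs L s) = 1 := by
  have h : ∀ n, coeff (1 : Hs L s) n = if n = 0 then 1 else 0 := fun n => coeff_ofCoeff _ _ _
  rw [toC, tsum_eq_single 0 fun n hn => by rw [h, if_neg hn, zero_smul], h, if_pos rfl, one_smul]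
  ext x
  simp

theorem toC_zero : toC (0 : Hs L s) = 0 := by
  simpa using toC_smul (0 : ℂ) (0 : Hs L s)

instance : CommRing (Hs L s) where
  __ := (inferInstance : AddCommGroup (Hs L s))
  mul_assoc f g h := toC_injective (by simp only [toC_mul, mul_assoc])
  one_mul f := toC_injective (by simp only [toC_mul, toC_one, one_mul])
  mul_one f := toC_injective (by simp only [toC_mul, toC_one, mul_one])
  left_distrib f g h := toC_injective (by simp only [toC_mul, toC_add, mul_add])
  right_distrib f g h := toC_injective (by simp only [toC_mul, toC_add, add_mul])
  zero_mul f := toC_injective (by simp only [toC_mul, toC_zero, zero_mul])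
  mul_zero f := toC_injective (by simp only [toC_mul, toC_zero, mul_zero])
  mul_comm f g := toC_injective (by simp only [toC_mul, mul_comm])

instance : IsScalarTower ℂ (Hs L s) (Hs L s) where
  smul_assoc c f g := toC_injective (by simp only [smul_eq_mul, toC_mul, toC_smul, smul_mul_assoc])

instance : SMulCommClass ℂ (Hs L s) (Hs L s) where
  smul_comm c f g := toC_injective (by simp only [smul_eq_mul, toC_mul, toC_smul, mul_smul_comm])

instance : StarRing (Hs L s) where
  star_involutive f := toC_injective (by simp only [toC_star, star_star])
  star_mul f g := toC_injective (by simp only [toC_mul, toC_star, star_mul, mul_comm])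
  star_add f g := toC_injective (by simp only [toC_add, toC_star, star_add])

instance : StarModule ℂ (Hs L s) where
  star_smul c f := toC_injective (by simp only [toC_smul, toC_star, star_smul])

theorem wiener_mul_le (f g : Hs L s) : wiener (f * g) ≤ wiener f * wiener g := by
  have hf := summable_coeff f
  have hg := summable_coeff g
  have hfg := summable_mul_of_summable_norm (f := fun n => ‖coeff f n‖)
    (g := fun n => ‖coeff g n‖) (by simpa using hf) (by simpa using hg)
  let e : ℤ × ℤ ≃ ℤ × ℤ :=
    { toFun := fun p => (p.2, p.1 - p.2)
      invFun := fun p => (p.1 + p.2, p.1)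
      left_inv := fun p => by simp
      right_inv := fun p => by simp }
  have hfg' := e.summable_iff.2 hfg
  have h1 : wiener f * wiener g = ∑' n, ∑' k, ‖coeff f k‖ * ‖coeff g (n - k)‖ := by
    rw [wiener, wiener, tsum_mul_tsum_of_summable_norm (by simpa using hf) (by simpa using hg),
      ← e.tsum_eq]
    exact hfg'.tsum_prod
  rw [h1]
  refine Summable.tsum_le_tsum (fun n => ?_) (summable_coeff _) hfg'.prod
  rw [coeff_mul]
  refine (norm_tsum_le_tsum_norm ?_).trans ?_
  · simpa only [norm_mul] using summable_coeff_mul f g n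
  · simp only [norm_mul]
    exact le_rfl

/-! ## The `L²` inner product -/

/-- The `L²` inner product. -/
def ip (f g : Hs L s) : ℂ := inner ℂ f.toL2 g.toL2

theorem ip_eq_integral (f g : Hs L s) :
    ip f g = ∫ x, toC g x * conj (toC f x) ∂(haarAddCircle : Measure (Torus L)) := by
  rw [ip, ← toLp_toC, ← toLp_toC, ContinuousMap.inner_toLp]

theorem ip_mul_right (f g h : Hs L s) : ip f (g * h) = ip (f * star g) h := by
  rw [ip_eq_integral, ip_eq_integral]
  congr 1
  funext x
  simp only [toC_mul, toC_star, ContinuousMap.mul_apply, ContinuousMap.star_apply, map_mul,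
    RCLike.star_def, Complex.conj_conj]
  ring

theorem ip_star_star (f g : Hs L s) : ip (star f) (star g) = ip g f := by
  rw [ip_eq_integral, ip_eq_integral]
  congr 1
  funext x
  simp only [toC_star, ContinuousMap.star_apply, RCLike.star_def, Complex.conj_conj]
  ring

theorem ip_conj (f g : Hs L s) : conj (ip f g) = ip g f := inner_conj_symm _ _

theorem ip_add_right (f g h : Hs L s) : ip f (g + h) = ip f g + ip f h := by
  simp only [ip, map_add, inner_add_right]

theorem ip_add_left (f g h : Hs L s) : ip (f + g) h = ip f h + ip g h := by
  simp only [ip, map_add, inner_add_left]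

theorem ip_smul_right (c : ℂ) (f g : Hs L s) : ip f (c • g) = c * ip f g := by
  simp only [ip, map_smul, inner_smul_right]

theorem ip_smul_left (c : ℂ) (f g : Hs L s) : ip (c • f) g = conj c * ip f g := by
  simp only [ip, map_smul, inner_smul_left]

theorem norm_ip_le (f g : Hs L s) : ‖ip f g‖ ≤ ‖f.toL2‖ * ‖g.toL2‖ := norm_inner_le_norm _ _

theorem ip_self (f : Hs L s) : ip f f = ((‖f.toL2‖ ^ 2 : ℝ) : ℂ) := by
  rw [ip, inner_self_eq_norm_sq_to_K]
  simp

theorem hasSum_ip (f g : Hs L s) : HasSum (fun n => conj (coeff f n) * coeff g n) (ip f g) := by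
  have h := lp.hasSum_inner (𝕜 := ℂ) (fourierBasis.repr f.toL2) (fourierBasis.repr g.toL2)
  rw [LinearIsometryEquiv.inner_map_map] at h
  refine h.congr_fun fun n => ?_
  rw [coeff_eq_repr, coeff_eq_repr]
  exact mul_comm _ _

/-- The Wiener norm dominates the supremum norm. -/
theorem norm_toL2_mul_le (f g : Hs L s) : ‖(f * g).toL2‖ ≤ wiener f * ‖g.toL2‖ := by
  refine Lp.norm_le_mul_norm_of_ae_le_mul ?_
  filter_upwards [toC_ae_eq (f * g), toC_ae_eq g] with x h1 h2
  change ‖(f * g).toFun x‖ ≤ _ * ‖g.toFun x‖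
  rw [← h1, ← h2, toC_mul, ContinuousMap.mul_apply, norm_mul]
  gcongr
  exact ((toC f).norm_coe_le_norm x).trans (norm_toC_le f)

/-- Real-valuedness in terms of Fourier coefficients. -/
theorem star_eq_self_iff {f : Hs L s} : star f = f ↔ ∀ n, conj (coeff f (-n)) = coeff f n :=
  ⟨fun h n => by rw [← coeff_star, h], fun h => ext_coeff fun n => by rw [coeff_star, h]⟩

/-- Continuous functions that agree almost everywhere for Haar measure agree everywhere. -/
theorem IsReal.star_eq {f : Hs L s} (hf : f.IsReal) : star f = f := by
  apply toC_injective
  have h : ⇑(star (toC f)) =ᵐ[haarAddCircle] toC f := by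
    filter_upwards [hf, toC_ae_eq f] with x h1 h2
    rw [← h2] at h1
    rw [ContinuousMap.star_apply, RCLike.star_def, Complex.conj_eq_iff_im]
    exact h1
  rw [toC_star]
  exact ContinuousMap.coe_injective
    ((star (toC f)).continuous.ae_eq_iff_eq _ (toC f).continuous |>.1 h)

end Hs

namespace Hs

variable {L s : ℝ} [Fact (0 < 2 * L)] [Fact (1 ≤ s)]

instance : Fact ((1 : ℝ) ≤ 1) := ⟨le_rfl⟩

/-! ## The inclusion `H^s ⊆ H^r` -/

section incl

variable {r : ℝ} [Fact (1 ≤ r)]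

theorem toL2_mk (f : L2Torus L) (hf : f ∈ sobolevSubmodule L r) :
    toL2 (⟨f, hf⟩ : Hs L r) = f := rfl

@[simp] theorem toL2_incl (h : r ≤ s) (f : Hs L s) : toL2 (incl h f) = toL2 f := toL2_mk _ _

@[simp] theorem coeff_incl (h : r ≤ s) (f : Hs L s) (n : ℤ) : coeff (incl h f) n = coeff f n := by
  rw [coeff, toL2_incl, coeff]

theorem norm_incl_le (h : r ≤ s) (f : Hs L s) : ‖incl h f‖ ≤ ‖f‖ := by
  refine (norm_le_of_coeff_le (absSeq f) fun n => ?_).trans (norm_absSeq f).le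
  rw [absSeq_apply, coeff_incl]
  exact mul_le_mul_of_nonneg_right (sobolevWeight_mono L h n) (norm_nonneg _)

theorem incl_add (h : r ≤ s) (f g : Hs L s) : incl h (f + g) = incl h f + incl h g :=
  ext_coeff fun n => by simp only [coeff_incl, coeff_add]

theorem incl_smul (h : r ≤ s) (c : ℂ) (f : Hs L s) : incl h (c • f) = c • incl h f :=
  ext_coeff fun n => by simp only [coeff_incl, coeff_smul]

/-- The inclusion `H^s ⊆ H^r` as a continuous linear map. -/
def inclL (h : r ≤ s) : Hs L s →L[ℂ] Hs L r :=
  LinearMap.mkContinuous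
    { toFun := fun f => incl h f
      map_add' := fun f g => incl_add h f g
      map_smul' := fun c f => incl_smul h c f } 1
    fun f => by simpa using norm_incl_le h f

@[simp] theorem inclL_apply (h : r ≤ s) (f : Hs L s) : inclL h f = incl h f := rfl

theorem incl_mul (h : r ≤ s) (f g : Hs L s) : incl h (f * g) = incl h f * incl h g :=
  ext_coeff fun n => by simp only [coeff_incl, coeff_mul]

theorem incl_star (h : r ≤ s) (f : Hs L s) : incl h (star f) = star (incl h f) :=
  ext_coeff fun n => by simp only [coeff_incl, coeff_star]

theorem wiener_incl (h : r ≤ s) (f : Hs L s) : wiener (incl h f) = wiener f := by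
  simp only [wiener, coeff_incl]

end incl

/-! ## The characters and finite Fourier sums -/

variable (L s) in
/-- The `n`-th character as an element of `H^s`. -/
def character (n : ℤ) : Hs L s :=
  seqEquiv.symm (lp.single (E := fun _ : ℤ => ℂ) 2 n (sobolevWeight L s n : ℂ))

theorem toSeq_smul_character (c : ℂ) (n : ℤ) :
    seqEquiv (c • character L s n) =
      lp.single (E := fun _ : ℤ => ℂ) 2 n ((sobolevWeight L s n : ℂ) * c) := by
  rw [map_smul, character, LinearIsometryEquiv.apply_symm_apply, ← lp.single_smul, smul_eq_mul,
    mul_comm]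

theorem coeff_character (n m : ℤ) : coeff (character L s n) m = if m = n then 1 else 0 := by
  have h := toSeq_smul_character (L := L) (s := s) 1 n
  rw [one_smul, mul_one] at h
  have h2 := congrArg (fun a : lp (fun _ : ℤ => ℂ) 2 => a m) h
  simp only [seqEquiv_apply] at h2
  have hw : (sobolevWeight L s m : ℂ) ≠ 0 := by exact_mod_cast (sobolevWeight_pos L s m).ne'
  by_cases hm : m = n
  · subst hm
    rw [if_pos rfl]
    refine mul_left_cancel₀ hw ?_
    rw [h2, mul_one]
    simp
  · rw [if_neg hm]
    refine mul_left_cancel₀ hw ?_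
    rw [h2, mul_zero]
    simp [hm]

theorem hasSum_character (f : Hs L s) : HasSum (fun n => coeff f n • character L s n) f := by
  have h := lp.hasSum_single (E := fun _ : ℤ => ℂ) (p := 2) (by norm_num) (seqEquiv f)
  have h2 := h.mapL (seqEquiv (L := L) (s := s)).symm.toContinuousLinearEquiv.toContinuousLinearMap
  change HasSum (fun n => seqEquiv.symm (lp.single (E := fun _ : ℤ => ℂ) 2 n (seqEquiv f n)))
    (seqEquiv.symm (seqEquiv f)) at h2
  rw [LinearIsometryEquiv.symm_apply_apply] at h2
  refine h2.congr_fun fun n => ?_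
  rw [seqEquiv_apply, ← toSeq_smul_character, LinearIsometryEquiv.symm_apply_apply]

/-- The Fourier multiplier with a finitely supported symbol. -/
def finMultiplier (F : Finset ℤ) (m : ℤ → ℂ) : Hs L s →L[ℂ] Hs L s :=
  ∑ n ∈ F, m n • (coeffL n).smulRight (character L s n)

theorem finMultiplier_apply (F : Finset ℤ) (m : ℤ → ℂ) (f : Hs L s) :
    finMultiplier F m f = ∑ n ∈ F, (m n * coeff f n) • character L s n := by
  simp [finMultiplier, mul_smul]

@[simp] theorem coeff_finMultiplier (F : Finset ℤ) (m : ℤ → ℂ) (f : Hs L s) (n : ℤ) :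
    coeff (finMultiplier F m f) n = if n ∈ F then m n * coeff f n else 0 := by
  rw [finMultiplier_apply, coeff_sum]
  simp [coeff_character]

/-- The projection on finitely many Fourier modes. -/
def proj (F : Finset ℤ) : Hs L s →L[ℂ] Hs L s := finMultiplier F 1

@[simp] theorem coeff_proj (F : Finset ℤ) (f : Hs L s) (n : ℤ) :
    coeff (proj F f) n = if n ∈ F then coeff f n else 0 := by
  simp [proj]

theorem norm_proj_le (F : Finset ℤ) (f : Hs L s) : ‖proj F f‖ ≤ ‖f‖ := by
  rw [← one_mul ‖f‖]
  refine norm_le_of_norm_coeff_le zero_le_one fun n => ?_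
  rw [coeff_proj, one_mul]
  split_ifs
  · exact le_rfl
  · simp

/-- This monotonicity makes Dini's theorem applicable to the Fourier tails along a compact curve. -/
theorem norm_sub_proj_anti (f : Hs L s) {F G : Finset ℤ} (h : F ≤ G) :
    ‖f - proj G f‖ ≤ ‖f - proj F f‖ := by
  rw [← one_mul ‖f - proj F f‖]
  refine norm_le_of_norm_coeff_le zero_le_one fun n => ?_
  simp only [coeff_sub, coeff_proj, one_mul]
  by_cases h1 : n ∈ F
  · simp [h1, h h1]
  · by_cases h2 : n ∈ G <;> simp [h1, h2]

theorem tendsto_proj (f : Hs L s) : Tendsto (fun F => proj F f) atTop (𝓝 f) := by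
  refine (hasSum_character f).congr fun F => ?_
  simp [proj, finMultiplier_apply]

/-- The Fourier projections converge uniformly along a continuous curve on a compact set. -/
theorem tendstoUniformlyOn_proj {X : Type*} [TopologicalSpace X] {K : Set X} (hK : IsCompact K)
    {u : X → Hs L s} (hu : ContinuousOn u K) :
    TendstoUniformlyOn (fun F x => ‖u x - proj F (u x)‖) (fun _ => 0) atTop K := by
  refine Antitone.tendstoUniformlyOn_of_forall_tendsto hK (fun F => ?_) (fun x _ F G h => ?_)
    continuousOn_const fun x _ => ?_
  · exact (hu.sub ((proj F).continuous.comp_continuousOn hu)).norm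
  · exact norm_sub_proj_anti _ h
  · have := (tendsto_proj (u x)).const_sub (u x)
    rw [sub_self] at this
    simpa using this.norm

/-! ## The free Schrödinger group -/

/-- The symbol of `exp (i t ∂ₓ² / 2)`. -/
def phase (L t : ℝ) (n : ℤ) : ℂ := Complex.exp ((-(freq L n ^ 2 / 2 * t) : ℝ) * Complex.I)

theorem norm_phase (L t : ℝ) (n : ℤ) : ‖phase L t n‖ = 1 := Complex.norm_exp_ofReal_mul_I _

theorem phase_zero (L : ℝ) (n : ℤ) : phase L 0 n = 1 := by simp [phase]

theorem phase_add (L t t' : ℝ) (n : ℤ) : phase L (t + t') n = phase L t n * phase L t' n := by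
  rw [phase, phase, phase, ← Complex.exp_add]
  congr 1
  push_cast
  ring

theorem phase_neg_mul (L t : ℝ) (n : ℤ) : phase L (-t) n * phase L t n = 1 := by
  rw [← phase_add, neg_add_cancel, phase_zero]

theorem hasDerivAt_phase (L t : ℝ) (n : ℤ) :
    HasDerivAt (fun τ => phase L τ n) (-Complex.I * (freq L n ^ 2 / 2) * phase L t n) t := by
  have h1 : HasDerivAt (fun τ : ℝ => ((-(freq L n ^ 2 / 2 * τ) : ℝ) : ℂ))
      ((-(freq L n ^ 2 / 2 * 1) : ℝ) : ℂ) t :=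
    (((hasDerivAt_id t).const_mul _).neg).ofReal_comp
  have h2 := (h1.mul_const Complex.I).cexp
  refine h2.congr_deriv ?_
  rw [phase]
  push_cast
  ring

theorem continuous_phase (L : ℝ) (n : ℤ) : Continuous fun t => phase L t n :=
  continuous_iff_continuousAt.2 fun t => (hasDerivAt_phase L t n).continuousAt

theorem memlp_phase_mul (t : ℝ) (f : Hs L s) :
    Memℓp (fun n => (sobolevWeight L s n : ℂ) * (phase L t n * coeff f n)) 2 :=
  memlp_of_le (absSeq f) fun n => by rw [absSeq_apply, norm_mul, norm_phase, one_mul]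

/-- The free Schrödinger group `exp (i t ∂ₓ² / 2)`. -/
def free (t : ℝ) : Hs L s →ₗᵢ[ℂ] Hs L s where
  toFun f := ofCoeff (fun n => phase L t n * coeff f n) (memlp_phase_mul t f)
  map_add' f g := ext_coeff fun n => by simp [mul_add]
  map_smul' c f := ext_coeff fun n => by simp [mul_left_comm]
  norm_map' f := norm_eq_of_norm_coeff_eq fun n => by
    change ‖coeff (ofCoeff _ (memlp_phase_mul t f)) n‖ = _
    rw [coeff_ofCoeff, norm_mul, norm_phase, one_mul]

@[simp] theorem coeff_free (t : ℝ) (f : Hs L s) (n : ℤ) :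
    coeff (free t f) n = phase L t n * coeff f n :=
  coeff_ofCoeff _ (memlp_phase_mul t f) n

@[simp] theorem free_zero (f : Hs L s) : free 0 f = f := ext_coeff fun n => by simp [phase_zero]

@[simp] theorem free_neg_free (t : ℝ) (f : Hs L s) : free (-t) (free t f) = f :=
  ext_coeff fun n => by rw [coeff_free, coeff_free, ← mul_assoc, phase_neg_mul, one_mul]

@[simp] theorem free_free_neg (t : ℝ) (f : Hs L s) : free t (free (-t) f) = f := by
  simpa using free_neg_free (-t) f

theorem incl_free {r : ℝ} [Fact (1 ≤ r)] (h : r ≤ s) (t : ℝ) (f : Hs L s) :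
    incl h (free t f) = free t (incl h f) :=
  ext_coeff fun n => by simp

theorem norm_toL2_free (t : ℝ) (f : Hs L s) : ‖(free t f).toL2‖ = ‖f.toL2‖ := by
  rw [← (fourierBasis (T := 2 * L)).repr.norm_map, ← (fourierBasis (T := 2 * L)).repr.norm_map,
    lp.norm_eq_tsum_rpow (by norm_num), lp.norm_eq_tsum_rpow (by norm_num)]
  congr 2
  funext n
  rw [← coeff_eq_repr, ← coeff_eq_repr, coeff_free, norm_mul, norm_phase, one_mul]

/-- The group is isometric, so the curve is a limit, uniform in `t`, of finite sums of continuously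
rotating modes. -/
theorem continuous_free_apply (f : Hs L s) : Continuous fun t => free t f := by
  have h : TendstoUniformly (fun (F : Finset ℤ) (t : ℝ) => free t (proj F f))
      (fun t => free t f) atTop := by
    rw [Metric.tendstoUniformly_iff]
    intro ε hε
    filter_upwards [Metric.tendsto_nhds.1 (tendsto_proj f) ε hε] with F hF t
    rw [(free t).dist_map, dist_comm]
    exact hF
  refine h.continuous (Frequently.of_forall fun F => ?_)
  have : (fun t => free t (proj F f)) =
      fun t => ∑ n ∈ F, (phase L t n * coeff f n) • character L s n := by
    funext t
    refine ext_coeff fun n => ?_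
    simp [coeff_character]
  rw [this]
  exact continuous_finsetSum _ fun n _ =>
    ((continuous_phase L n).mul continuous_const).smul continuous_const

theorem continuous_free : Continuous fun p : ℝ × Hs L s => free p.1 p.2 :=
  continuous_prod_of_continuous_lipschitzWith' _ 1 (fun t => (free t).lipschitz)
    fun f => continuous_free_apply f

/-! ## Topology of the ring operations -/

/-- The product as a bounded bilinear map over `ℝ`. -/
def mulL : Hs L s →L[ℝ] Hs L s →L[ℝ] Hs L s :=
  LinearMap.mkContinuous₂
    (LinearMap.mk₂ ℝ (fun f g : Hs L s => f * g) add_mul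
      (fun c f g => smul_mul_assoc (c : ℂ) f g) mul_add
      fun c f g => mul_smul_comm (c : ℂ) f g)
    (mulConst L s) norm_mul_le'

instance : ContinuousMul (Hs L s) where
  continuous_mul := (mulL (L := L) (s := s)).continuous₂

instance : NormedStarGroup (Hs L s) where
  norm_star_le f := (norm_star' f).le

/-! ## The nonlinearity -/

/-- The nonlinearity `W u + α |u|² u`. -/
def nonlin (W : Hs L s) (α : ℝ) (u : Hs L s) : Hs L s := W * u + (α : ℂ) • (u * star u * u)

theorem incl_nonlin {r : ℝ} [Fact (1 ≤ r)] (h : r ≤ s) (W : Hs L s) (α : ℝ) (u : Hs L s) :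
    incl h (nonlin W α u) = nonlin (incl h W) α (incl h u) := by
  simp only [nonlin, incl_add, incl_smul, incl_mul, incl_star]

theorem continuous_nonlin (α : ℝ) : Continuous fun p : Hs L s × Hs L s => nonlin p.1 α p.2 := by
  unfold nonlin
  fun_prop

/-- Telescoping the cubic term one factor at a time. The potential varies too, because measurability
in the parameter will come from continuity in `W`. -/
theorem exists_nonlin_lipschitz (L s : ℝ) [Fact (0 < 2 * L)] [Fact (1 ≤ s)] (α R : ℝ) :
    ∃ K : ℝ≥0, ∀ W W' u u' : Hs L s, ‖W‖ ≤ R → ‖W'‖ ≤ R → ‖u‖ ≤ R → ‖u'‖ ≤ R →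
      ‖nonlin W α u - nonlin W' α u'‖ ≤ K * (‖u - u'‖ + ‖W - W'‖) := by
  set M := mulConst L s with hM
  have hM0 : 0 ≤ M := mulConst_nonneg
  refine ⟨⟨M * |R| + |α| * (3 * (M * |R|) ^ 2), by positivity⟩, fun W W' u u' hW hW' hu hu' => ?_⟩
  have hR : R ≤ |R| := le_abs_self R
  have mul_bd : ∀ {f g : Hs L s} {a b : ℝ}, ‖f‖ ≤ a → ‖g‖ ≤ b → ‖f * g‖ ≤ M * a * b := by
    intro f g a b hf hg
    refine (norm_mul_le' f g).trans ?_
    have := (norm_nonneg f).trans hf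
    gcongr
  have hsu : ‖star u‖ ≤ R := by rwa [norm_star]
  have e : nonlin W α u - nonlin W' α u' = W * (u - u') + (W - W') * u' +
      (α : ℂ) • ((u - u') * star u * u + u' * star (u - u') * u + u' * star u' * (u - u')) := by
    have e2 : (u - u') * star u * u + u' * star (u - u') * u + u' * star u' * (u - u') =
        u * star u * u - u' * star u' * u' := by
      rw [star_sub]
      ring
    rw [e2, nonlin, nonlin, smul_sub]
    ring
  set d := ‖u - u'‖ with hd
  have hd0 : 0 ≤ d := norm_nonneg _
  have hds : ‖star (u - u')‖ ≤ d := by rw [norm_star]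
  have b1 := mul_bd (hW.trans hR) hd.ge
  have b2 := mul_bd (le_refl ‖W - W'‖) (hu'.trans hR)
  have b3 := mul_bd (mul_bd hd.ge (hsu.trans hR)) (hu.trans hR)
  have b4 := mul_bd (mul_bd (hu'.trans hR) hds) (hu.trans hR)
  have b5 := mul_bd (mul_bd (hu'.trans hR) ((norm_star u').le.trans (hu'.trans hR))) hd.ge
  rw [e]
  refine (norm_add_le _ _).trans ?_
  have b6 : ‖(α : ℂ) • ((u - u') * star u * u + u' * star (u - u') * u +
      u' * star u' * (u - u'))‖ ≤ |α| * (3 * (M * |R|) ^ 2 * d) := by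
    rw [norm_smul, Complex.norm_real, Real.norm_eq_abs]
    gcongr
    refine (norm_add₃_le).trans ?_
    refine (add_le_add (add_le_add b3 b4) b5).trans (le_of_eq ?_)
    ring
  have b7 := norm_add_le (W * (u - u')) ((W - W') * u')
  change _ ≤ (M * |R| + |α| * (3 * (M * |R|) ^ 2)) * (d + ‖W - W'‖)
  -- Slack: the cubic term does not see `W - W'`, but a single constant serves both differences.
  have b8 : 0 ≤ |α| * (3 * (M * |R|) ^ 2) * ‖W - W'‖ := by positivity
  nlinarith

theorem nonlin_zero (W : Hs L s) (α : ℝ) : nonlin W α 0 = 0 := by simp [nonlin]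

theorem wiener_mul_norm_bound (f g : Hs L s) {a : ℝ} (hf : ‖f‖ ≤ a) {w b : ℝ}
    (hw : wiener f ≤ w) (hg : ‖g‖ ≤ b) {w' : ℝ} (hw' : wiener g ≤ w') :
    ‖f * g‖ ≤ 2 ^ s * (a * w' + w * b) := by
  refine (norm_mul_le_tame f g).trans ?_
  have h1 := (norm_nonneg f).trans hf
  have h2 := (wiener_nonneg f).trans hw
  have h3 := wiener_nonneg g
  gcongr

/-- The nonlinearity grows linearly in `H^s` when the Wiener norm is controlled. -/
theorem exists_nonlin_tame (L s : ℝ) [Fact (0 < 2 * L)] [Fact (1 ≤ s)] (α R : ℝ) :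
    ∃ K : ℝ, 0 ≤ K ∧ ∀ W u : Hs L s, ‖W‖ ≤ R → wiener u ≤ R →
      ‖nonlin W α u‖ ≤ K * ‖u‖ := by
  -- The cubic coefficient is two tame products: `|u|²` has `H^s` norm at most `2 ^ s * (R + R) *
  -- ‖u‖` and Wiener norm at most `R * R`, and is then multiplied by `u`.
  refine ⟨mulConst L s * |R| + |α| * (2 ^ s * (2 ^ s * (R + R) * R + R * R)), ?_,
    fun W u hW hu => ?_⟩
  · have := mulConst_nonneg (L := L) (s := s)
    have hp : 0 ≤ R * R := mul_self_nonneg R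
    have : 0 ≤ 2 ^ s * (2 ^ s * (R + R) * R + R * R) := by
      have : 2 ^ s * (R + R) * R = 2 * 2 ^ s * (R * R) := by ring
      rw [this]
      positivity
    positivity
  have hsu : wiener (star u) ≤ R := by rwa [wiener_star]
  have h1 := wiener_mul_norm_bound u (star u) le_rfl hu (norm_star u).le hsu
  have h2 : wiener (u * star u) ≤ R * R := (wiener_mul_le _ _).trans
    (mul_le_mul hu hsu (wiener_nonneg _) ((wiener_nonneg _).trans hu))
  have h3 := wiener_mul_norm_bound (u * star u) u h1 h2 le_rfl hu
  have h4 := norm_mul_le' W u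
  have h5 : mulConst L s * ‖W‖ * ‖u‖ ≤ mulConst L s * |R| * ‖u‖ := by
    have := mulConst_nonneg (L := L) (s := s)
    have := le_abs_self R
    gcongr
    linarith
  rw [nonlin]
  refine (norm_add_le _ _).trans ?_
  rw [norm_smul, Complex.norm_real, Real.norm_eq_abs, add_mul]
  refine add_le_add (h4.trans h5) ?_
  rw [mul_assoc |α|]
  gcongr
  refine h3.trans (le_of_eq ?_)
  ring

end Hs

/-! ## Global solutions of ordinary differential equations with an a priori bound -/

section ODE

variable {E : Type*} [NormedAddCommGroup E] [NormedSpace ℝ E]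

/-- `v` solves `v' = F t v` on `[0, T]`. -/
def IsODESolution (F : ℝ → E → E) (T : ℝ) (v : ℝ → E) : Prop :=
  ∀ t ∈ Icc 0 T, HasDerivWithinAt v (F t (v t)) (Icc 0 T) t

namespace IsODESolution

variable {F G : ℝ → E → E} {v w : ℝ → E} {T : ℝ}

theorem continuousOn (h : IsODESolution F T v) : ContinuousOn v (Icc 0 T) :=
  fun t ht => (h t ht).continuousWithinAt

theorem mono (h : IsODESolution F T v) {τ : ℝ} (hτ : τ ≤ T) : IsODESolution F τ v :=
  fun t ht => (h t ⟨ht.1, ht.2.trans hτ⟩).mono (Icc_subset_Icc_right hτ)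

theorem hasDerivWithinAt_Ici (h : IsODESolution F T v) {t : ℝ} (ht : t ∈ Ico 0 T) :
    HasDerivWithinAt v (F t (v t)) (Ici t) t :=
  (h t ⟨ht.1, ht.2.le⟩).mono_of_mem_nhdsWithin (Icc_mem_nhdsGE_of_mem ht)

theorem hasDerivAt (h : IsODESolution F T v) {t : ℝ} (ht : t ∈ Ioo 0 T) :
    HasDerivAt v (F t (v t)) t :=
  (h t ⟨ht.1.le, ht.2.le⟩).hasDerivAt (Icc_mem_nhds ht.1 ht.2)

theorem congr (h : IsODESolution F T v) (hw : EqOn w v (Icc 0 T)) : IsODESolution F T w := by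
  intro t ht
  rw [hw ht]
  exact (h t ht).congr hw (hw ht)

theorem congr_field (h : IsODESolution F T v) (hG : ∀ t ∈ Icc 0 T, G t (v t) = F t (v t)) :
    IsODESolution G T v := by
  intro t ht
  rw [hG t ht]
  exact h t ht

theorem exists_bound (h : IsODESolution F T v) : ∃ R, ∀ t ∈ Icc 0 T, ‖v t‖ ≤ R :=
  isCompact_Icc.exists_bound_of_continuousOn h.continuousOn

/-- Gronwall for two different fields: a change of potential is treated as an error of size `ε` in
the field. -/
theorem dist_le (hv : IsODESolution F T v) (hw : IsODESolution G T w) {R ε : ℝ} {K : ℝ≥0}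
    (hvR : ∀ t ∈ Icc 0 T, ‖v t‖ ≤ R) (hwR : ∀ t ∈ Icc 0 T, ‖w t‖ ≤ R)
    (hF : ∀ t, LipschitzOnWith K (F t) (Metric.closedBall 0 R))
    (hG : ∀ t x, ‖x‖ ≤ R → dist (G t x) (F t x) ≤ ε) :
    ∀ t ∈ Icc 0 T, dist (v t) (w t) ≤ gronwallBound (dist (v 0) (w 0)) K ε t := by
  intro t ht
  have h := dist_le_of_approx_trajectories_ODE_of_mem (v := F) (s := fun _ => Metric.closedBall 0 R)
    (K := K) (f := v) (g := w) (f' := fun t => F t (v t)) (g' := fun t => G t (w t)) (a := 0)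
    (b := T) (εf := 0) (εg := ε) (fun t _ => hF t)
    hv.continuousOn (fun t ht => hv.hasDerivWithinAt_Ici ht) (fun t _ => by simp)
    (fun t ht => by simpa using hvR t ⟨ht.1, ht.2.le⟩)
    hw.continuousOn (fun t ht => hw.hasDerivWithinAt_Ici ht)
    (fun t ht => hG t _ (hwR t ⟨ht.1, ht.2.le⟩))
    (fun t ht => by simpa using hwR t ⟨ht.1, ht.2.le⟩) le_rfl t ht
  simpa using h

theorem eqOn (hF : ∀ R, ∃ K : ℝ≥0, ∀ t, LipschitzOnWith K (F t) (Metric.closedBall 0 R))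
    (hv : IsODESolution F T v) (hw : IsODESolution F T w) (h0 : v 0 = w 0) :
    EqOn v w (Icc 0 T) := by
  obtain ⟨R₁, h1⟩ := hv.exists_bound
  obtain ⟨R₂, h2⟩ := hw.exists_bound
  obtain ⟨K, hK⟩ := hF (max R₁ R₂)
  intro t ht
  have h := hv.dist_le hw (ε := 0) (fun t ht => (h1 t ht).trans (le_max_left _ _))
    (fun t ht => (h2 t ht).trans (le_max_right _ _)) hK (fun t x _ => by simp) t ht
  rw [h0, dist_self, gronwallBound_ε0_δ0] at h
  exact dist_le_zero.1 h

end IsODESolution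

/-- A Lipschitz cutoff, equal to `1` on the ball of radius `R` and to `0` off the ball of radius
`R + 1`. -/
def normCutoff (R : ℝ) (x : E) : ℝ := max 0 (min 1 (R + 1 - ‖x‖))

theorem normCutoff_nonneg (R : ℝ) (x : E) : 0 ≤ normCutoff R x := le_max_left _ _

theorem normCutoff_le_one (R : ℝ) (x : E) : normCutoff R x ≤ 1 :=
  max_le zero_le_one (min_le_left _ _)

theorem normCutoff_of_le {R : ℝ} {x : E} (h : ‖x‖ ≤ R) : normCutoff R x = 1 := by
  rw [normCutoff, min_eq_left (by linarith), max_eq_right zero_le_one]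

theorem normCutoff_of_ge {R : ℝ} {x : E} (h : R + 1 ≤ ‖x‖) : normCutoff R x = 0 := by
  rw [normCutoff, max_eq_left ((min_le_right _ _).trans (by linarith))]

theorem abs_normCutoff_sub_le (R : ℝ) (x y : E) :
    |normCutoff R x - normCutoff R y| ≤ ‖x - y‖ := by
  refine (abs_max_sub_max_le_max _ _ _ _).trans ?_
  rw [sub_self, abs_zero, max_eq_right (abs_nonneg _)]
  refine (abs_min_sub_min_le_max _ _ _ _).trans ?_
  rw [sub_self, abs_zero, max_eq_right (abs_nonneg _)]
  have : R + 1 - ‖x‖ - (R + 1 - ‖y‖) = ‖y‖ - ‖x‖ := by ring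
  rw [this, norm_sub_rev]
  exact abs_norm_sub_norm_le _ _

variable [CompleteSpace E] {F : ℝ → E → E}

/-- The cut-off field is bounded by `M` on the whole space, so trajectories stay within `M * T` of
the start and one application of Picard–Lindelöf covers all of `[0, T]`. -/
theorem exists_isODESolution_cutoff
    (hF : ∀ R, ∃ K : ℝ≥0, ∀ t, LipschitzOnWith K (F t) (Metric.closedBall 0 R))
    (hb : ∀ R, ∃ M : ℝ≥0, ∀ t x, ‖x‖ ≤ R → ‖F t x‖ ≤ M) (hc : ∀ x, Continuous fun t => F t x)
    (x₀ : E) (R : ℝ) {T : ℝ} (hT : 0 ≤ T) :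
    ∃ v : ℝ → E, v 0 = x₀ ∧ IsODESolution (fun t x => normCutoff R x • F t x) T v := by
  obtain ⟨M, hM⟩ := hb (R + 1)
  have hbd : ∀ t x, ‖normCutoff R x • F t x‖ ≤ M := fun t x => by
    rw [norm_smul, Real.norm_of_nonneg (normCutoff_nonneg R x)]
    rcases le_total ‖x‖ (R + 1) with h | h
    · calc _ ≤ 1 * (M : ℝ) := mul_le_mul (normCutoff_le_one R x) (hM t x h) (norm_nonneg _)
            zero_le_one
        _ = M := one_mul _
    · rw [normCutoff_of_ge h, zero_mul]
      exact M.2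
  set a : ℝ≥0 := M * ⟨T, hT⟩ with ha
  obtain ⟨K, hK⟩ := hF (‖x₀‖ + a)
  obtain ⟨M', hM'⟩ := hb (‖x₀‖ + a)
  have hball : ∀ x ∈ Metric.closedBall x₀ (a : ℝ), ‖x‖ ≤ ‖x₀‖ + a := fun x hx => by
    rw [mem_closedBall_iff_norm] at hx
    linarith [norm_le_norm_add_norm_sub' x x₀]
  have hpl : IsPicardLindelof (fun t x => normCutoff R x • F t x) (tmin := 0) (tmax := T)
      ⟨0, le_rfl, hT⟩ x₀ a 0 M (M' + K) := by
    refine ⟨fun t _ => ?_, fun x _ => ?_, fun t _ x _ => hbd t x, ?_⟩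
    · refine LipschitzOnWith.of_dist_le_mul fun x hx y hy => ?_
      have h1 := (hK t).dist_le_mul x (by simpa using hball x hx) y (by simpa using hball y hy)
      rw [dist_eq_norm, dist_eq_norm] at *
      have e : normCutoff R x • F t x - normCutoff R y • F t y =
          (normCutoff R x - normCutoff R y) • F t x + normCutoff R y • (F t x - F t y) := by
        rw [sub_smul, smul_sub]
        abel
      rw [e]
      refine (norm_add_le _ _).trans ?_
      rw [norm_smul, norm_smul, Real.norm_eq_abs, Real.norm_of_nonneg (normCutoff_nonneg R y)]
      have h2 := abs_normCutoff_sub_le R x y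
      have h3 := hM' t x (hball x hx)
      calc _ ≤ ‖x - y‖ * M' + 1 * (K * ‖x - y‖) :=
            add_le_add (mul_le_mul h2 h3 (norm_nonneg _) (norm_nonneg _))
              (mul_le_mul (normCutoff_le_one R y) h1 (norm_nonneg _) zero_le_one)
        _ = _ := by
            push_cast
            ring
    · exact (continuous_const.smul (hc x)).continuousOn
    · simp only [sub_zero, sub_self, NNReal.coe_zero, max_eq_left hT]
      exact le_rfl
  obtain ⟨v, h0, hv⟩ := hpl.exists_eq_forall_mem_Icc_hasDerivWithinAt₀
  exact ⟨v, h0, hv⟩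

/-- A continuation principle on a bounded interval. -/
theorem exists_isODESolution_of_apriori
    (hF : ∀ R, ∃ K : ℝ≥0, ∀ t, LipschitzOnWith K (F t) (Metric.closedBall 0 R))
    (hb : ∀ R, ∃ M : ℝ≥0, ∀ t x, ‖x‖ ≤ R → ‖F t x‖ ≤ M) (hc : ∀ x, Continuous fun t => F t x)
    {x₀ : E} {T : ℝ} (hT : 0 ≤ T) {B : ℝ}
    (hB : ∀ τ ∈ Icc 0 T, ∀ v, v 0 = x₀ → IsODESolution F τ v → ‖v τ‖ ≤ B) :
    ∃ v : ℝ → E, v 0 = x₀ ∧ IsODESolution F T v := by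
  -- The cutoff leaves a unit margin above `B`: up to the first time the norm reaches `B + 1` the
  -- curve solves the original equation, so the a priori bound contradicts reaching it.
  obtain ⟨v, h0, hv⟩ := exists_isODESolution_cutoff hF hb hc x₀ (B + 1) hT
  have hsol : ∀ τ ≤ T, (∀ t ∈ Icc 0 τ, ‖v t‖ ≤ B + 1) → IsODESolution F τ v := fun τ hτ h =>
    (hv.mono hτ).congr_field fun t ht => by
      rw [normCutoff_of_le (h t ht), one_smul]
  refine ⟨v, h0, hsol T le_rfl ?_⟩
  by_contra! hcon
  obtain ⟨t₁, ht₁, hlt⟩ := hcon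
  have hcn : ContinuousOn (fun t => ‖v t‖) (Icc 0 T) := hv.continuousOn.norm
  have hS : IsCompact (Icc 0 T ∩ (fun t => ‖v t‖) ⁻¹' Ici (B + 1)) :=
    isCompact_Icc.of_isClosed_subset (hcn.preimage_isClosed_of_isClosed isClosed_Icc isClosed_Ici)
      inter_subset_left
  obtain ⟨τ, ⟨hτ, hτB⟩, hmin⟩ := hS.exists_isLeast ⟨t₁, ht₁, hlt.le⟩
  have hbefore : ∀ t ∈ Ico 0 τ, ‖v t‖ ≤ B + 1 := fun t ht => by
    by_contra! h
    exact absurd (hmin ⟨⟨ht.1, ht.2.le.trans hτ.2⟩, h.le⟩) (not_le.2 ht.2)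
  have hτB' : B + 1 ≤ ‖v τ‖ := hτB
  -- At `τ = 0` being a solution is vacuous on a single point, so `hB` bounds the datum itself.
  rcases hτ.1.eq_or_lt with h | hpos
  · have : IsODESolution F 0 v := fun t ht => by
      have : t = 0 := le_antisymm ht.2 ht.1
      subst this
      rw [Icc_self]
      exact hasDerivWithinAt_iff_hasFDerivWithinAt.2 (.of_subsingleton subsingleton_singleton)
    have := hB 0 ⟨le_rfl, hT⟩ v h0 this
    rw [← h] at hτB'
    linarith
  · have hle : ∀ t ∈ Icc 0 τ, ‖v t‖ ≤ B + 1 := by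
      have hcl : Icc 0 τ ⊆ closure (Ico 0 τ) := by rw [closure_Ico hpos.ne]
      intro t ht
      have hcw : ContinuousWithinAt (fun t => ‖v t‖) (Ico 0 τ) t :=
        (hcn t ⟨ht.1, ht.2.trans hτ.2⟩).mono fun x hx => ⟨hx.1, hx.2.le.trans hτ.2⟩
      have := hcw.mem_closure (hcl ht) (t := Iic (B + 1)) fun x hx => hbefore x hx
      simpa using this
    have := hB τ hτ v h0 (hsol τ hτ.2 hle)
    linarith

/-- Global existence from an a priori bound on bounded intervals. -/
theorem exists_global_isODESolution
    (hF : ∀ R, ∃ K : ℝ≥0, ∀ t, LipschitzOnWith K (F t) (Metric.closedBall 0 R))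
    (hb : ∀ R, ∃ M : ℝ≥0, ∀ t x, ‖x‖ ≤ R → ‖F t x‖ ≤ M) (hc : ∀ x, Continuous fun t => F t x)
    {x₀ : E} (hB : ∀ T, ∃ B, ∀ τ ∈ Icc 0 T, ∀ v, v 0 = x₀ → IsODESolution F τ v → ‖v τ‖ ≤ B) :
    ∃ v : ℝ → E, v 0 = x₀ ∧ ∀ T, IsODESolution F T v := by
  have hex : ∀ n : ℕ, ∃ v : ℝ → E, v 0 = x₀ ∧ IsODESolution F n v := fun n => by
    obtain ⟨B, hB⟩ := hB n
    exact exists_isODESolution_of_apriori hF hb hc n.cast_nonneg hB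
  choose w hw0 hw using hex
  -- Uniqueness makes the solutions on integer intervals agree, so evaluating the `⌈t⌉₊`-th one at
  -- `t` glues them.
  have heq : ∀ n : ℕ, EqOn (fun t => w ⌈t⌉₊ t) (w n) (Icc 0 n) := fun n t ht => by
    have h1 : t ≤ ⌈t⌉₊ := Nat.le_ceil t
    exact ((hw ⌈t⌉₊).mono h1).eqOn hF ((hw n).mono ht.2) (by rw [hw0, hw0]) ⟨ht.1, le_rfl⟩
  refine ⟨fun t => w ⌈t⌉₊ t, hw0 _, fun T => ?_⟩
  exact ((hw ⌈T⌉₊).congr (heq _)).mono (Nat.le_ceil T)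

end ODE

namespace Hs

variable {L s : ℝ} [Fact (0 < 2 * L)] [Fact (1 ≤ s)]

/-! ## The equation in the interaction picture -/

/-- The vector field of the equation for `v t = free (-t) (u t)`. -/
def field (W : Hs L s) (α : ℝ) (t : ℝ) (v : Hs L s) : Hs L s :=
  free (-t) ((-Complex.I) • nonlin W α (free t v))

theorem norm_field_sub (W W' : Hs L s) (α t : ℝ) (v v' : Hs L s) :
    ‖field W α t v - field W' α t v'‖ = ‖nonlin W α (free t v) - nonlin W' α (free t v')‖ := by
  rw [field, field, ← map_sub, (free _).norm_map, ← smul_sub, norm_smul]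
  simp

theorem norm_field (W : Hs L s) (α t : ℝ) (v : Hs L s) :
    ‖field W α t v‖ = ‖nonlin W α (free t v)‖ := by
  rw [field, (free _).norm_map, norm_smul]
  simp

theorem exists_field_lipschitz (L s : ℝ) [Fact (0 < 2 * L)] [Fact (1 ≤ s)] (α R : ℝ) :
    ∃ K : ℝ≥0, ∀ (t : ℝ) (W W' v v' : Hs L s), ‖W‖ ≤ R → ‖W'‖ ≤ R → ‖v‖ ≤ R → ‖v'‖ ≤ R →
      dist (field W α t v) (field W' α t v') ≤ K * (dist v v' + dist W W') := by
  obtain ⟨K, hK⟩ := exists_nonlin_lipschitz L s α R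
  refine ⟨K, fun t W W' v v' hW hW' hv hv' => ?_⟩
  rw [dist_eq_norm, norm_field_sub]
  have h := hK W W' (free t v) (free t v') hW hW' (by rwa [(free t).norm_map])
    (by rwa [(free t).norm_map])
  rwa [← map_sub, (free t).norm_map, ← dist_eq_norm v, ← dist_eq_norm W] at h

theorem field_lipschitzOnWith (W : Hs L s) (α R : ℝ) :
    ∃ K : ℝ≥0, ∀ t, LipschitzOnWith K (field W α t) (Metric.closedBall 0 R) := by
  obtain ⟨K, hK⟩ := exists_field_lipschitz L s α (max R ‖W‖)
  refine ⟨K, fun t => LipschitzOnWith.of_dist_le_mul fun v hv v' hv' => ?_⟩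
  have h := hK t W W v v' (le_max_right _ _) (le_max_right _ _)
    ((mem_closedBall_zero_iff.1 hv).trans (le_max_left _ _))
    ((mem_closedBall_zero_iff.1 hv').trans (le_max_left _ _))
  rwa [dist_self, add_zero] at h

theorem field_zero (W : Hs L s) (α t : ℝ) : field W α t 0 = 0 := by
  simp [field, nonlin_zero]

theorem field_bounded (W : Hs L s) (α R : ℝ) :
    ∃ M : ℝ≥0, ∀ t v, ‖v‖ ≤ R → ‖field W α t v‖ ≤ M := by
  obtain ⟨K, hK⟩ := field_lipschitzOnWith W α (|R|)
  refine ⟨K * ⟨|R|, abs_nonneg R⟩, fun t v hv => ?_⟩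
  have hv' : ‖v‖ ≤ |R| := hv.trans (le_abs_self R)
  have h := (hK t).dist_le_mul v (mem_closedBall_zero_iff.2 hv') 0 (by simp)
  rw [field_zero, dist_zero_right, dist_zero_right] at h
  refine h.trans ?_
  exact mul_le_mul_of_nonneg_left hv' K.2

theorem continuous_field (W : Hs L s) (α : ℝ) :
    Continuous fun p : ℝ × Hs L s => field W α p.1 p.2 := by
  have h1 : Continuous fun p : ℝ × Hs L s => (-Complex.I) • nonlin W α (free p.1 p.2) := by
    have h0 := (continuous_nonlin α).comp' ((continuous_const (y := W)).prodMk continuous_free)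
    fun_prop
  exact Continuous.comp'
    (f := fun p : ℝ × Hs L s => (-p.1, (-Complex.I) • nonlin W α (free p.1 p.2)))
    continuous_free (continuous_fst.neg.prodMk h1)

theorem incl_field {r : ℝ} [Fact (1 ≤ r)] (h : r ≤ s) (W : Hs L s) (α t : ℝ) (v : Hs L s) :
    incl h (field W α t v) = field (incl h W) α t (incl h v) := by
  rw [field, field, incl_free, incl_smul, incl_nonlin, incl_free]

/-- The field commutes with the inclusion. This transfers `H¹` bounds to `H^s` solutions and
identifies them as `H¹` solutions. -/
theorem _root_.IsODESolution.incl {r : ℝ} [Fact (1 ≤ r)] (h : r ≤ s) {W : Hs L s} {α T : ℝ}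
    {v : ℝ → Hs L s} (hv : IsODESolution (field W α) T v) :
    IsODESolution (field (incl h W) α) T fun t => incl h (v t) := fun t ht => by
  have h1 := ((inclL (L := L) h).restrictScalars ℝ).hasFDerivAt.comp_hasDerivWithinAt t (hv t ht)
  refine h1.congr_deriv ?_
  change inclL h (field W α t (v t)) = _
  rw [inclL_apply, incl_field]

/-! ## Conservation of mass -/

theorem ip_free_free (t : ℝ) (f g : Hs L s) : ip (free t f) (free t g) = ip f g := by
  refine (hasSum_ip _ _).unique ((hasSum_ip f g).congr_fun fun n => ?_)
  have h : conj (phase L t n) * phase L t n = 1 := by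
    rw [Complex.conj_mul', norm_phase]
    simp
  rw [coeff_free, coeff_free, map_mul]
  linear_combination (conj (coeff f n) * coeff g n) * h

theorem ip_mul_self_comm {W : Hs L s} (hW : star W = W) (u w : Hs L s) :
    ip u (W * w) = ip (W * u) w := by
  rw [ip_mul_right, hW, mul_comm]

theorem star_mul_star_self (u : Hs L s) : star (u * star u) = u * star u := by
  rw [star_mul, star_star]

/-- The nonlinearity multiplies `u` by the real function `W + α |u|²`, a self-adjoint operation. -/
theorem ip_nonlin_real {W : Hs L s} (hW : star W = W) (α : ℝ) (u : Hs L s) :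
    conj (ip u (nonlin W α u)) = ip u (nonlin W α u) := by
  have h1 : conj (ip u (W * u)) = ip u (W * u) := by
    rw [ip_conj, ip_mul_self_comm hW]
  have h2 : conj (ip u (u * star u * u)) = ip u (u * star u * u) := by
    rw [ip_conj, ip_mul_self_comm (star_mul_star_self u)]
  rw [nonlin, ip_add_right, ip_smul_right, map_add, map_mul, h1, h2, Complex.conj_ofReal]

theorem _root_.HasDerivWithinAt.hs_ip {f g : ℝ → Hs L s} {f' g' : Hs L s} {S : Set ℝ} {t : ℝ}
    (hf : HasDerivWithinAt f f' S t) (hg : HasDerivWithinAt g g' S t) :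
    HasDerivWithinAt (fun τ => ip (f τ) (g τ)) (ip (f t) g' + ip f' (g t)) S t :=
  HasDerivWithinAt.inner ℂ
    (((toL2L (L := L) (s := s)).restrictScalars ℝ).hasFDerivAt.comp_hasDerivWithinAt t hf)
    (((toL2L (L := L) (s := s)).restrictScalars ℝ).hasFDerivAt.comp_hasDerivWithinAt t hg)

theorem _root_.HasDerivWithinAt.hs_mul {f g : ℝ → Hs L s} {f' g' : Hs L s} {S : Set ℝ} {t : ℝ}
    (hf : HasDerivWithinAt f f' S t) (hg : HasDerivWithinAt g g' S t) :
    HasDerivWithinAt (fun τ => f τ * g τ) (f t * g' + f' * g t) S t :=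
  mulL.hasDerivWithinAt_of_bilinear hf hg

theorem _root_.HasDerivWithinAt.hs_star {f : ℝ → Hs L s} {f' : Hs L s} {S : Set ℝ} {t : ℝ}
    (hf : HasDerivWithinAt f f' S t) : HasDerivWithinAt (fun τ => star (f τ)) (star f') S t :=
  hf.star

/-- The derivative is twice the real part of `-i` times a real number. In the interaction picture
the kinetic term is absent, so no truncation is needed. -/
theorem mass_conservation {W : Hs L s} (hW : star W = W) {α T : ℝ} {v : ℝ → Hs L s}
    (hv : IsODESolution (field W α) T v) {t : ℝ} (ht : t ∈ Icc 0 T) :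
    ‖(v t).toL2‖ = ‖(v 0).toL2‖ := by
  have hd : ∀ τ ∈ Icc 0 T, HasDerivWithinAt (fun τ => ip (v τ) (v τ)) 0 (Icc 0 T) τ := by
    intro τ hτ
    refine ((hv τ hτ).hs_ip (hv τ hτ)).congr_deriv ?_
    set N := nonlin W α (free τ (v τ)) with hN
    have h1 : ip (v τ) (field W α τ (v τ)) = -Complex.I * ip (free τ (v τ)) N := by
      rw [← ip_free_free τ, field, free_free_neg, ip_smul_right]
    rw [← ip_conj (v τ), h1, map_mul, hN, ip_nonlin_real hW]
    simp
  have h := Convex.norm_image_sub_le_of_norm_hasDerivWithin_le (C := 0) hd (fun _ _ => by simp)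
    (convex_Icc 0 T) ⟨le_rfl, ht.1.trans ht.2⟩ ht
  rw [zero_mul, norm_le_zero_iff, sub_eq_zero, ip_self, ip_self, Complex.ofReal_inj] at h
  exact (pow_left_inj₀ (norm_nonneg _) (norm_nonneg _) two_ne_zero).1 h

/-! ## Conservation of energy -/

/-- The operator `-∂ₓ² / 2` on the Fourier modes in `F`. -/
def kinetic (F : Finset ℤ) : Hs L s →L[ℂ] Hs L s :=
  finMultiplier F fun n => ((freq L n ^ 2 / 2 : ℝ) : ℂ)

@[simp] theorem coeff_kinetic (F : Finset ℤ) (f : Hs L s) (n : ℤ) :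
    coeff (kinetic F f) n = if n ∈ F then ((freq L n ^ 2 / 2 : ℝ) : ℂ) * coeff f n else 0 :=
  coeff_finMultiplier _ _ _ _

theorem ip_kinetic_comm (F : Finset ℤ) (f g : Hs L s) :
    ip f (kinetic F g) = ip (kinetic F f) g := by
  refine (hasSum_ip _ _).unique ((hasSum_ip _ g).congr_fun fun n => ?_)
  rw [coeff_kinetic, coeff_kinetic]
  split_ifs
  · rw [map_mul, Complex.conj_ofReal]
    ring
  · simp

theorem ip_proj_comm (F : Finset ℤ) (f g : Hs L s) : ip f (proj F g) = ip (proj F f) g := by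
  refine (hasSum_ip _ _).unique ((hasSum_ip _ g).congr_fun fun n => ?_)
  rw [coeff_proj, coeff_proj]
  split_ifs <;> simp

theorem kinetic_proj (F : Finset ℤ) (f : Hs L s) : kinetic F (proj F f) = kinetic F f :=
  ext_coeff fun n => by
    simp only [coeff_kinetic, coeff_proj]
    split_ifs <;> rfl

theorem proj_kinetic (F : Finset ℤ) (f : Hs L s) : proj F (kinetic F f) = kinetic F f :=
  ext_coeff fun n => by
    simp only [coeff_kinetic, coeff_proj]
    split_ifs <;> rfl

theorem proj_proj (F : Finset ℤ) (f : Hs L s) : proj F (proj F f) = proj F f :=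
  ext_coeff fun n => by
    simp only [coeff_proj]
    split_ifs <;> rfl

/-- The two derivatives are shared between the factors. The bound is uniform in `F`, as the limit
over projections requires. -/
theorem norm_ip_kinetic_le (F : Finset ℤ) (f g : Hs L s) :
    ‖ip f (kinetic F g)‖ ≤ ‖f‖ * ‖g‖ := by
  rw [← (hasSum_ip f (kinetic F g)).tsum_eq]
  have hb : ∀ n, ‖conj (coeff f n) * coeff (kinetic F g) n‖ ≤
      inner ℝ (absSeq f n) (absSeq g n) := fun n => by
    have e : inner ℝ (absSeq f n) (absSeq g n) =
        sobolevWeight L s n ^ 2 * (‖coeff f n‖ * ‖coeff g n‖) := by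
      rw [absSeq_apply, absSeq_apply]
      change sobolevWeight L s n * ‖coeff g n‖ * (sobolevWeight L s n * ‖coeff f n‖) = _
      ring
    have hw : freq L n ^ 2 / 2 ≤ sobolevWeight L s n ^ 2 := by
      have h1 := pow_le_pow_left₀ (sobolevWeight_pos L 1 n).le
        (sobolevWeight_mono L (Fact.out : 1 ≤ s) n) 2
      rw [sobolevWeight_one_sq] at h1
      nlinarith [sq_nonneg (freq L n)]
    rw [e, norm_mul, RCLike.norm_conj, coeff_kinetic]
    split_ifs
    · rw [norm_mul, Complex.norm_real, Real.norm_of_nonneg (by positivity), mul_left_comm]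
      gcongr
    · simp only [norm_zero, mul_zero]
      positivity
  have hsum := lp.summable_inner (𝕜 := ℝ) (absSeq f) (absSeq g)
  refine (tsum_of_norm_bounded hsum.hasSum hb).trans ?_
  rw [← lp.inner_eq_tsum, ← norm_absSeq f, ← norm_absSeq g]
  exact real_inner_le_norm _ _

/-- The truncated energy as a complex number. -/
def energyFun (F : Finset ℤ) (W : Hs L s) (α : ℝ) (p : Hs L s) : ℂ :=
  1 / 2 * ip p (kinetic F p) + 1 / 2 * ip p (W * p) +
    (α : ℂ) / 4 * ip (p * star p) (p * star p)

/-- The gradient of the truncated energy at `p` is `kinetic F p + nonlin W α p`; self-adjointness of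
each piece pairs every term with its conjugate. -/
theorem hasDerivWithinAt_energyFun (F : Finset ℤ) {W : Hs L s} (hW : star W = W) (α : ℝ)
    {p : ℝ → Hs L s} {p' : Hs L s} {S : Set ℝ} {t : ℝ} (hp : HasDerivWithinAt p p' S t) :
    HasDerivWithinAt (fun τ => energyFun F W α (p τ))
      (((ip p' (kinetic F (p t) + nonlin W α (p t))).re : ℝ) : ℂ) S t := by
  have hk : HasDerivWithinAt (fun τ => kinetic F (p τ)) (kinetic F p') S t :=
    ((kinetic (L := L) (s := s) F).restrictScalars ℝ).hasFDerivAt.comp_hasDerivWithinAt t hp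
  have hw : HasDerivWithinAt (fun τ => W * p τ) (W * p') S t :=
    ((hasDerivWithinAt_const t S W).hs_mul hp).congr_deriv (by rw [zero_mul, add_zero])
  have hq := hp.hs_mul hp.hs_star
  refine ((((hp.hs_ip hk).const_mul (1 / 2 : ℂ)).add ((hp.hs_ip hw).const_mul (1 / 2 : ℂ))).add
    ((hq.hs_ip hq).const_mul ((α : ℂ) / 4))).congr_deriv ?_
  set z₁ := ip p' (kinetic F (p t)) with hz1
  set z₂ := ip p' (W * p t) with hz2
  set z₃ := ip p' (p t * star (p t) * p t) with hz3
  have e1 : ip (p t) (kinetic F p') = conj z₁ := by rw [ip_kinetic_comm, hz1, ip_conj]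
  have e2 : ip (p t) (W * p') = conj z₂ := by rw [ip_mul_self_comm hW, hz2, ip_conj]
  have e3 : ip (p' * star (p t)) (p t * star (p t)) = z₃ := by
    rw [← ip_mul_right, hz3]
    congr 1
    ring
  have e4 : ip (p t * star p') (p t * star (p t)) = conj z₃ := by
    rw [← e3, ip_conj, ← ip_star_star, star_mul_star_self, star_mul, star_star]
  have e5 : ip (p t * star p' + p' * star (p t)) (p t * star (p t)) = conj z₃ + z₃ := by
    rw [ip_add_left, e3, e4]
  have e6 : ip (p t * star (p t)) (p t * star p' + p' * star (p t)) = z₃ + conj z₃ := by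
    rw [← ip_conj, e5, map_add, Complex.conj_conj]
  have e7 : ip p' (kinetic F (p t) + nonlin W α (p t)) = z₁ + (z₂ + α * z₃) := by
    rw [nonlin, ip_add_right, ip_add_right, ip_smul_right]
  have e8 : ((((z₁ + (z₂ + α * z₃)).re : ℝ)) : ℂ) =
      (z₁ + (z₂ + α * z₃) + (conj z₁ + (conj z₂ + α * conj z₃))) / 2 := by
    rw [Complex.re_eq_add_conj]
    simp only [map_add, map_mul, Complex.conj_ofReal]
  rw [e1, e2, e5, e6, e7, e8]
  ring

/-- With finitely many modes, differentiating the phases costs no regularity. -/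
theorem hasDerivWithinAt_proj (F : Finset ℤ) {W : Hs L s} {α T : ℝ} {v : ℝ → Hs L s}
    (hv : IsODESolution (field W α) T v) {t : ℝ} (ht : t ∈ Icc 0 T) :
    HasDerivWithinAt (fun τ => proj F (free τ (v τ)))
      ((-Complex.I) • (kinetic F (free t (v t)) + proj F (nonlin W α (free t (v t)))))
      (Icc 0 T) t := by
  have e : (fun τ => proj F (free τ (v τ))) =
      fun τ => ∑ n ∈ F, (phase L τ n * coeff (v τ) n) • character L s n := by
    funext τ
    exact ext_coeff fun n => by simp [coeff_character]
  rw [e]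
  have h : ∀ n ∈ F, HasDerivWithinAt (fun τ => (phase L τ n * coeff (v τ) n) • character L s n)
      ((-Complex.I * (freq L n ^ 2 / 2) * phase L t n * coeff (v t) n +
        phase L t n * coeff (field W α t (v t)) n) • character L s n) (Icc 0 T) t := fun n _ =>
    ((hasDerivAt_phase L t n).hasDerivWithinAt.mul
      (((coeffL (L := L) (s := s) n).restrictScalars ℝ).hasFDerivAt.comp_hasDerivWithinAt t
        (hv t ht))).smul_const _
  refine (HasDerivWithinAt.fun_sum h).congr_deriv ?_
  refine ext_coeff fun n => ?_
  have hph := phase_neg_mul L t n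
  simp only [coeff_sum, coeff_smul, coeff_character, coeff_add, coeff_kinetic, coeff_proj,
    coeff_free, field, mul_ite, mul_one, mul_zero, Finset.sum_ite_eq]
  split_ifs
  · push_cast
    linear_combination (-Complex.I * coeff (nonlin W α (free t (v t))) n) * hph
  · simp

/-- With `X` the gradient at `p = proj F u`, the velocity is `-i (proj F X + proj F r)`. The first
part pairs with `X` to `i` times the squared `L²` norm of `proj F X`, which has no real part; only
the commutator error `r` survives. -/
theorem abs_energy_deriv_le (F : Finset ℤ) (W : Hs L s) (α : ℝ) (u : Hs L s) :
    |(ip ((-Complex.I) • (kinetic F u + proj F (nonlin W α u)))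
      (kinetic F (proj F u) + nonlin W α (proj F u))).re| ≤
      ‖nonlin W α u - nonlin W α (proj F u)‖ * (‖proj F u‖ + ‖nonlin W α (proj F u)‖) := by
  set p := proj F u with hp
  set r := nonlin W α u - nonlin W α p with hr
  set X := kinetic F p + nonlin W α p with hX
  have e1 : kinetic F u + proj F (nonlin W α u) = proj F X + proj F r := by
    rw [hX, hr, map_add, map_sub, proj_kinetic, hp, kinetic_proj]
    abel
  have e2 : ip (proj F X) X = ((‖(proj F X).toL2‖ ^ 2 : ℝ) : ℂ) := by
    rw [← ip_self, ip_proj_comm, proj_proj]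
  have e3 : (ip ((-Complex.I) • (kinetic F u + proj F (nonlin W α u))) X).re =
      (Complex.I * ip (proj F r) X).re := by
    rw [e1, ip_smul_left, ip_add_left, e2, mul_add, Complex.add_re]
    simp [-Complex.ofReal_pow]
  rw [e3]
  refine (Complex.abs_re_le_norm _).trans ?_
  rw [norm_mul, Complex.norm_I, one_mul, hX, ip_add_right, mul_add]
  refine (norm_add_le _ _).trans (add_le_add ?_ ?_)
  · refine (norm_ip_kinetic_le F _ _).trans ?_
    exact mul_le_mul_of_nonneg_right (norm_proj_le F r) (norm_nonneg _)
  · refine (norm_ip_le _ _).trans ?_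
    exact mul_le_mul ((norm_toL2_le _).trans (norm_proj_le F r)) (norm_toL2_le _) (norm_nonneg _)
      (norm_nonneg _)

/-- The energy in `H¹`. -/
def energy (W : Hs L 1) (α : ℝ) (u : Hs L 1) : ℝ :=
  1 / 4 * (‖u‖ ^ 2 - ‖u.toL2‖ ^ 2) + 1 / 2 * (ip u (W * u)).re + α / 4 * ‖(u * star u).toL2‖ ^ 2

theorem continuous_energy (W : Hs L 1) (α : ℝ) : Continuous (energy W α) := by
  have h1 : Continuous fun u : Hs L 1 => ‖u.toL2‖ := (toL2L (L := L) (s := 1)).continuous.norm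
  have h2 : Continuous fun u : Hs L 1 => ip u (W * u) :=
    (toL2L (L := L) (s := 1)).continuous.inner
      ((toL2L (L := L) (s := 1)).continuous.comp (continuous_const.mul continuous_id))
  have h3 : Continuous fun u : Hs L 1 => ‖(u * star u).toL2‖ :=
    h1.comp (continuous_id.mul continuous_star)
  unfold energy
  fun_prop

/-- Since `p` has no modes outside `F`, truncation loses nothing, and the squared `H¹` norm minus
the squared `L²` norm is exactly the sum of `freq² |p̂|²`. -/
theorem energyFun_re (F : Finset ℤ) (W : Hs L 1) (α : ℝ) {p : Hs L 1} (hp : proj F p = p) :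
    (energyFun F W α p).re = energy W α p := by
  have h1 : HasSum (fun n => (conj (coeff p n) * coeff (kinetic F p) n).re)
      (ip p (kinetic F p)).re := Complex.hasSum_re (hasSum_ip _ _)
  have h2 : HasSum (fun n => ‖coeff p n‖ ^ 2) (‖p.toL2‖ ^ 2) := by
    have h := Complex.hasSum_re (hasSum_ip p p)
    rw [ip_self, Complex.ofReal_re] at h
    refine h.congr_fun fun n => ?_
    rw [Complex.conj_mul', ← Complex.ofReal_pow, Complex.ofReal_re]
  have h3 : HasSum (fun n => sobolevWeight L 1 n ^ 2 * ‖coeff p n‖ ^ 2) (‖p‖ ^ 2) := by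
    have h := lp.hasSum_norm (by norm_num) (absSeq p)
    simp only [ENNReal.toReal_ofNat, Real.rpow_ofNat, norm_absSeq] at h
    refine h.congr_fun fun n => ?_
    rw [absSeq_apply, ← mul_pow, Real.norm_eq_abs, sq_abs]
  have h4 : (ip p (kinetic F p)).re = 1 / 2 * (‖p‖ ^ 2 - ‖p.toL2‖ ^ 2) := by
    refine h1.unique (((h3.sub h2).mul_left (1 / 2)).congr_fun fun n => ?_)
    have hc : coeff p n = if n ∈ F then coeff p n else 0 := by
      rw [← coeff_proj, hp]
    rw [coeff_kinetic, sobolevWeight_one_sq]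
    split_ifs with hn
    · rw [mul_left_comm, Complex.conj_mul', ← Complex.ofReal_pow, ← Complex.ofReal_mul,
        Complex.ofReal_re]
      ring
    · rw [if_neg hn] at hc
      simp [hc]
  have h5 : ((1 / 2 : ℂ)) = ((1 / 2 : ℝ) : ℂ) := by norm_num
  have h6 : (α : ℂ) / 4 = ((α / 4 : ℝ) : ℂ) := by push_cast; rfl
  rw [energyFun, energy, h5, h6, Complex.add_re, Complex.add_re, Complex.re_ofReal_mul,
    Complex.re_ofReal_mul, Complex.re_ofReal_mul, h4, ip_self, Complex.ofReal_re]
  ring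

theorem exists_abs_energy_deriv_le (W : Hs L s) (α R : ℝ) :
    ∃ C : ℝ, 0 ≤ C ∧ ∀ (F : Finset ℤ) (u : Hs L s) (ε : ℝ), ‖u‖ ≤ R → ‖u - proj F u‖ ≤ ε →
      |(ip ((-Complex.I) • (kinetic F u + proj F (nonlin W α u)))
        (kinetic F (proj F u) + nonlin W α (proj F u))).re| ≤ C * ε := by
  obtain ⟨K, hK⟩ := exists_nonlin_lipschitz L s α (max R ‖W‖)
  have hR0 : 0 ≤ max R ‖W‖ := (norm_nonneg W).trans (le_max_right _ _)
  refine ⟨K * (max R ‖W‖ + K * max R ‖W‖), by positivity, fun F u ε hu hε => ?_⟩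
  refine (abs_energy_deriv_le F W α u).trans ?_
  have hn1 : ‖u‖ ≤ max R ‖W‖ := hu.trans (le_max_left _ _)
  have hn2 := (norm_proj_le F u).trans hn1
  have hd := hK W W _ _ (le_max_right _ _) (le_max_right _ _) hn1 hn2
  rw [sub_self, norm_zero, add_zero] at hd
  have hN := hK W W _ 0 (le_max_right _ _) (le_max_right _ _) hn2 (by simp)
  rw [nonlin_zero, sub_zero, sub_zero, sub_self, norm_zero, add_zero] at hN
  have hε0 := (norm_nonneg _).trans hε
  calc _ ≤ (K * ε) * (max R ‖W‖ + K * max R ‖W‖) := by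
        refine mul_le_mul (hd.trans ?_) (add_le_add hn2 (hN.trans ?_)) (by positivity)
          (by positivity)
        · exact mul_le_mul_of_nonneg_left hε K.2
        · exact mul_le_mul_of_nonneg_left hn2 K.2
    _ = _ := by ring

theorem abs_energy_proj_sub_le {W : Hs L 1} (hW : star W = W) {α T : ℝ} {v : ℝ → Hs L 1}
    (hv : IsODESolution (field W α) T v) (F : Finset ℤ) {B : ℝ}
    (hB : ∀ τ ∈ Icc 0 T,
      |(ip ((-Complex.I) • (kinetic F (free τ (v τ)) + proj F (nonlin W α (free τ (v τ)))))
        (kinetic F (proj F (free τ (v τ))) + nonlin W α (proj F (free τ (v τ))))).re| ≤ B)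
    {t : ℝ} (ht : t ∈ Icc 0 T) :
    |energy W α (proj F (free t (v t))) - energy W α (proj F (free 0 (v 0)))| ≤ B * t := by
  have h0 : (0 : ℝ) ∈ Icc 0 T := ⟨le_rfl, ht.1.trans ht.2⟩
  have h := Convex.norm_image_sub_le_of_norm_hasDerivWithin_le (C := B)
    (fun τ hτ => hasDerivWithinAt_energyFun F hW α (hasDerivWithinAt_proj F hv hτ))
    (fun τ hτ => by
      rw [Complex.norm_real, Real.norm_eq_abs]
      exact hB τ hτ)
    (convex_Icc 0 T) h0 ht
  rw [sub_zero, Real.norm_of_nonneg ht.1] at h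
  rw [← energyFun_re F W α (proj_proj F (free t (v t))),
    ← energyFun_re F W α (proj_proj F (free 0 (v 0))), ← Complex.sub_re]
  exact (Complex.abs_re_le_norm _).trans h

theorem nonpos_of_forall_le_mul {x C : ℝ} (hC : 0 ≤ C) (h : ∀ ε > 0, x ≤ C * ε) : x ≤ 0 := by
  by_contra! hx
  have h1 := h (x / (2 * (C + 1))) (by positivity)
  have h2 : C * (x / (2 * (C + 1))) ≤ x / 2 := by
    rw [← mul_div_assoc, div_le_div_iff₀ (by positivity) two_pos]
    nlinarith
  linarith

theorem continuousOn_free {X : Type*} [TopologicalSpace X] {S : Set X} {τ : X → ℝ} {v : X → Hs L s}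
    (hτ : ContinuousOn τ S) (hv : ContinuousOn v S) : ContinuousOn (fun x => free (τ x) (v x)) S :=
  Continuous.comp_continuousOn' (f := fun x => (τ x, v x)) continuous_free (hτ.prodMk hv)

theorem tendsto_energy_proj (W : Hs L 1) (α : ℝ) (u : Hs L 1) :
    Tendsto (fun F => energy W α (proj F u)) atTop (𝓝 (energy W α u)) :=
  ((continuous_energy W α).tendsto u).comp (tendsto_proj u)

/-- For large `F` the Fourier tails are below `ε` at all times of `[0, T]`, so the projected energy
drifts by at most `C * ε * t` with `C` independent of `F`. Let `F` exhaust `ℤ`, then `ε → 0`. -/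
theorem energy_conservation {W : Hs L 1} (hW : star W = W) {α T : ℝ} {v : ℝ → Hs L 1}
    (hv : IsODESolution (field W α) T v) {t : ℝ} (ht : t ∈ Icc 0 T) :
    energy W α (free t (v t)) = energy W α (v 0) := by
  obtain ⟨R, hR⟩ := hv.exists_bound
  have hu : ContinuousOn (fun τ => free τ (v τ)) (Icc 0 T) :=
    continuousOn_free continuousOn_id hv.continuousOn
  obtain ⟨C, hC0, hC⟩ := exists_abs_energy_deriv_le W α R
  have key : ∀ ε > 0, |energy W α (free t (v t)) - energy W α (free 0 (v 0))| ≤ C * ε * t := by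
    intro ε hε
    refine le_of_tendsto
      ((tendsto_energy_proj W α _).sub (tendsto_energy_proj W α _)).abs ?_
    filter_upwards [Metric.tendstoUniformlyOn_iff.1
      (tendstoUniformlyOn_proj isCompact_Icc hu) ε hε] with F hF
    refine abs_energy_proj_sub_le hW hv F (fun τ hτ => hC F _ ε ?_ ?_) ht
    · rw [(free τ).norm_map]
      exact hR τ hτ
    · have hFτ := hF τ hτ
      rw [dist_comm, dist_zero_right, norm_norm] at hFτ
      exact hFτ.le
  rw [← free_zero (v 0), ← sub_eq_zero, ← abs_nonpos_iff]
  refine nonpos_of_forall_le_mul (mul_nonneg hC0 ht.1) fun ε hε => ?_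
  rw [mul_right_comm]
  exact key ε hε

end Hs

namespace Hs

variable {L s : ℝ} [Fact (0 < 2 * L)] [Fact (1 ≤ s)]

/-! ## A priori bounds -/

theorem norm_sq_eq_energy (W : Hs L 1) (α : ℝ) (u : Hs L 1) :
    ‖u‖ ^ 2 = ‖u.toL2‖ ^ 2 + 4 * energy W α u - 2 * (ip u (W * u)).re -
      α * ‖(u * star u).toL2‖ ^ 2 := by
  rw [energy]
  ring

theorem abs_ip_potential_le (W u : Hs L 1) {m R : ℝ} (hm : ‖u.toL2‖ ≤ m) (hR : wiener W ≤ R) :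
    |(ip u (W * u)).re| ≤ R * m ^ 2 := by
  have hm0 := (norm_nonneg _).trans hm
  have hR0 := (wiener_nonneg _).trans hR
  calc |(ip u (W * u)).re| ≤ ‖u.toL2‖ * ‖(W * u).toL2‖ :=
        (Complex.abs_re_le_norm _).trans (norm_ip_le _ _)
    _ ≤ m * (R * m) := by
        refine mul_le_mul hm ((norm_toL2_mul_le W u).trans ?_) (norm_nonneg _) hm0
        exact mul_le_mul hR hm (norm_nonneg _) hR0
    _ = _ := by ring

theorem norm_toL2_mul_star_sq_le (u : Hs L s) {m a : ℝ} (hm : ‖u.toL2‖ ≤ m) (ha : wiener u ≤ a) :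
    ‖(u * star u).toL2‖ ^ 2 ≤ a ^ 2 * m ^ 2 := by
  have ha0 := (wiener_nonneg _).trans ha
  rw [← mul_pow]
  refine pow_le_pow_left₀ (norm_nonneg _) ?_ 2
  rw [mul_comm u, ← wiener_star] at *
  refine (norm_toL2_mul_le _ _).trans ?_
  exact mul_le_mul ha hm (norm_nonneg _) ha0

/-- Here `X` is the squared `H¹` norm and `q` the quartic term. The choice of `e` gives `a R² e² ≤ 1
/ 4`, so the quartic term costs at most `X / 2`, which moves to the left. -/
theorem absorb_quartic {X m en E p P a α q e D R : ℝ} (hX0 : 0 ≤ X) (ha : a = |α|)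
    (hX : X = m + 4 * en - 2 * p - α * q) (hm : m ≤ R ^ 2) (hen : en ≤ E) (hp : |p| ≤ P)
    (hq0 : 0 ≤ q) (hq : q ≤ (2 * (e ^ 2 * X) + 2 * D ^ 2) * R ^ 2)
    (he : e ^ 2 * (4 * (a * R ^ 2 + 1)) = 1) :
    X ≤ 2 * (R ^ 2 + 4 * E + 2 * P + a * (2 * D ^ 2 * R ^ 2)) := by
  have ha0 : 0 ≤ a := ha ▸ abs_nonneg α
  have h1 : -(α * q) ≤ a * q := by
    have := mul_le_mul_of_nonneg_right (neg_abs_le α) hq0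
    rw [ha]
    linarith
  have h2 := mul_le_mul_of_nonneg_left hq ha0
  have h3 : a * R ^ 2 * e ^ 2 ≤ 1 / 4 := by nlinarith [sq_nonneg e]
  have h4 := mul_le_mul_of_nonneg_right h3 hX0
  have h5 := neg_abs_le p
  nlinarith

/-- The uniform bound in `H¹`, from conservation of mass and energy. -/
theorem exists_h1_bound (L : ℝ) [Fact (0 < 2 * L)] (α R : ℝ) :
    ∃ B : ℝ, ∀ W : Hs L 1, star W = W → ‖W‖ ≤ R → ∀ (T : ℝ) (v : ℝ → Hs L 1),
      IsODESolution (field W α) T v → ‖v 0‖ ≤ R → ∀ t ∈ Icc 0 T, ‖v t‖ ≤ B := by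
  -- Tuned for `absorb_quartic`; the `+ 1` keeps it finite when `R = 0`.
  set ε : ℝ := (√(4 * (|α| * R ^ 2 + 1)))⁻¹ with hε
  have hε0 : 0 < ε := by positivity
  have hε2 : ε ^ 2 * (4 * (|α| * R ^ 2 + 1)) = 1 := by
    rw [hε, inv_pow, Real.sq_sqrt (by positivity), inv_mul_cancel₀ (by positivity)]
  obtain ⟨D, hD0, hD⟩ := exists_wiener_le L 1 hε0
  set A := ‖invWeight L 1‖ with hA
  set E₀ : ℝ := 1 / 4 * R ^ 2 + 1 / 2 * (A * R * R ^ 2) + |α| / 4 * ((A * R) ^ 2 * R ^ 2) with hE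
  set M : ℝ := R ^ 2 + 4 * E₀ + 2 * (A * R * R ^ 2) + |α| * (2 * (D * R) ^ 2 * R ^ 2) with hM
  refine ⟨√(2 * M), fun W hW hWR T v hv h0 t ht => ?_⟩
  set u := free t (v t) with hu
  have hmass : ‖u.toL2‖ ≤ R := by
    rw [hu, norm_toL2_free, mass_conservation hW hv ht]
    exact (norm_toL2_le _).trans h0
  have hR0 : 0 ≤ R := (norm_nonneg _).trans h0
  have hA0 : 0 ≤ A := norm_nonneg _
  have hwW : wiener W ≤ A * R := (wiener_le W).trans (by gcongr)
  have hen : energy W α u ≤ E₀ := by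
    rw [hu, energy_conservation hW hv ht, energy, hE]
    have hm0 := (norm_toL2_le (v 0)).trans h0
    have h1 := abs_ip_potential_le W (v 0) hm0 hwW
    have h2 := norm_toL2_mul_star_sq_le (v 0) hm0 ((wiener_le (v 0)).trans
      (mul_le_mul_of_nonneg_left h0 hA0))
    have h3 : ‖v 0‖ ^ 2 ≤ R ^ 2 := pow_le_pow_left₀ (norm_nonneg _) h0 2
    have h4 : α / 4 * ‖(v 0 * star (v 0)).toL2‖ ^ 2 ≤ |α| / 4 * ((A * R) ^ 2 * R ^ 2) :=
      mul_le_mul (by linarith [le_abs_self α]) h2 (by positivity) (by positivity)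
    nlinarith [le_abs_self (ip (v 0) (W * v 0)).re, sq_nonneg ‖(v 0).toL2‖]
  have hpot := abs_ip_potential_le W u hmass hwW
  have hwu : wiener u ≤ ε * ‖u‖ + D * R := (hD u).trans (by gcongr)
  have hq := norm_toL2_mul_star_sq_le u hmass hwu
  have hsq : (ε * ‖u‖ + D * R) ^ 2 ≤ 2 * (ε ^ 2 * ‖u‖ ^ 2) + 2 * (D * R) ^ 2 := by
    nlinarith [sq_nonneg (ε * ‖u‖ - D * R)]
  have hfin : ‖u‖ ^ 2 ≤ 2 * M :=
    absorb_quartic (sq_nonneg _) rfl (norm_sq_eq_energy W α u)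
      (pow_le_pow_left₀ (norm_nonneg _) hmass 2) hen hpot (sq_nonneg _)
      (hq.trans (mul_le_mul_of_nonneg_right hsq (sq_nonneg R))) hε2
  rw [← (free t).norm_map]
  exact Real.le_sqrt_of_sq_le hfin

/-- The bound in `H^s` on bounded time intervals. -/
theorem exists_hs_bound (L s : ℝ) [Fact (0 < 2 * L)] [Fact (1 ≤ s)] (α R T : ℝ) :
    ∃ B : ℝ, ∀ W : Hs L s, star W = W → ‖W‖ ≤ R → ∀ τ ≤ T, ∀ v : ℝ → Hs L s,
      IsODESolution (field W α) τ v → ‖v 0‖ ≤ R → ∀ t ∈ Icc 0 τ, ‖v t‖ ≤ B := by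
  have hs : 1 ≤ s := Fact.out
  obtain ⟨B, hB⟩ := exists_h1_bound L α R
  obtain ⟨K, hK0, hK⟩ := exists_nonlin_tame L s α (max R (‖invWeight L 1‖ * B))
  refine ⟨R * Real.exp (K * T), fun W hW hWR τ hτ v hv h0 t ht => ?_⟩
  have hR0 : 0 ≤ R := (norm_nonneg _).trans h0
  have hfield : ∀ x ∈ Ico 0 τ, ‖field W α x (v x)‖ ≤ K * ‖v x‖ + 0 := fun x hx => by
    have h1 := hB (incl hs W) (by rw [← incl_star, hW]) ((norm_incl_le hs W).trans hWR) τ _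
      (hv.incl hs) ((norm_incl_le hs _).trans h0) x ⟨hx.1, hx.2.le⟩
    have h2 : wiener (free x (v x)) ≤ ‖invWeight L 1‖ * B := by
      rw [← wiener_incl hs]
      refine (wiener_le _).trans ?_
      rw [incl_free, (free x).norm_map]
      gcongr
    have h3 := hK W (free x (v x)) (hWR.trans (le_max_left _ _)) (h2.trans (le_max_right _ _))
    rwa [norm_field, add_zero, ← (free x).norm_map (v x)]
  have h := norm_le_gronwallBound_of_norm_deriv_right_le hv.continuousOn
    (fun x hx => hv.hasDerivWithinAt_Ici hx) h0 hfield t ht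
  rw [gronwallBound_ε0, sub_zero] at h
  refine h.trans ?_
  have := ht.2.trans hτ
  gcongr

/-! ## The global flow -/

theorem exists_global (W : Hs L s) (hW : star W = W) (α : ℝ) (φ : Hs L s) :
    ∃ v : ℝ → Hs L s, v 0 = φ ∧ ∀ T, IsODESolution (field W α) T v := by
  refine exists_global_isODESolution (field_lipschitzOnWith W α) (field_bounded W α)
    (fun v => Continuous.comp' (f := fun t : ℝ => (t, v)) (continuous_field W α)
      (continuous_id.prodMk continuous_const)) fun T => ?_
  obtain ⟨B, hB⟩ := exists_hs_bound L s α (max ‖W‖ ‖φ‖) T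
  refine ⟨B, fun τ hτ v h0 hv => ?_⟩
  exact hB W hW (le_max_left _ _) τ hτ.2 v hv (by rw [h0]; exact le_max_right _ _) τ
    ⟨hτ.1, le_rfl⟩

open Classical in
/-- The global solution in the interaction picture, for a real potential `W`. -/
def flow (W : Hs L s) (α : ℝ) (φ : Hs L s) : ℝ → Hs L s :=
  if hW : star W = W then (exists_global W hW α φ).choose else fun _ => φ

theorem flow_spec {W : Hs L s} (hW : star W = W) (α : ℝ) (φ : Hs L s) :
    flow W α φ 0 = φ ∧ ∀ T, IsODESolution (field W α) T (flow W α φ) := by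
  rw [flow, dif_pos hW]
  exact (exists_global W hW α φ).choose_spec

/-- Lipschitz dependence of the solution on the initial datum and the potential. -/
theorem exists_flow_lipschitz (L s : ℝ) [Fact (0 < 2 * L)] [Fact (1 ≤ s)] (α R T : ℝ) :
    ∃ C : ℝ, 0 ≤ C ∧ ∀ W W' φ φ' : Hs L s, star W = W → star W' = W' → ‖W‖ ≤ R → ‖W'‖ ≤ R →
      ‖φ‖ ≤ R → ‖φ'‖ ≤ R → ∀ t ∈ Icc 0 T,
        dist (flow W α φ t) (flow W' α φ' t) ≤ C * (dist φ φ' + dist W W') := by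
  obtain ⟨B, hB⟩ := exists_hs_bound L s α R T
  obtain ⟨K, hK⟩ := exists_field_lipschitz L s α (max R B)
  have hK1 : ((K + 1 : ℝ≥0) : ℝ) ≠ 0 := by positivity
  refine ⟨Real.exp ((K + 1 : ℝ≥0) * T), by positivity,
    fun W W' φ φ' hW hW' hWR hWR' hφ hφ' t ht => ?_⟩
  obtain ⟨h0, h⟩ := flow_spec hW α φ
  obtain ⟨h0', h'⟩ := flow_spec hW' α φ'
  have hb := hB W hW hWR T le_rfl _ (h T) (by rwa [h0])
  have hb' := hB W' hW' hWR' T le_rfl _ (h' T) (by rwa [h0'])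
  have hd := (h T).dist_le (h' T) (R := max R B) (K := K + 1) (ε := (K + 1 : ℝ≥0) * dist W W')
    (fun t ht => (hb t ht).trans (le_max_right _ _))
    (fun t ht => (hb' t ht).trans (le_max_right _ _))
    (fun τ => LipschitzOnWith.of_dist_le_mul fun x hx y hy => by
      have := hK τ W W x y (hWR.trans (le_max_left _ _)) (hWR.trans (le_max_left _ _))
        (mem_closedBall_zero_iff.1 hx) (mem_closedBall_zero_iff.1 hy)
      rw [dist_self, add_zero] at this
      refine this.trans ?_
      gcongr
      exact_mod_cast le_self_add)
    (fun τ x hx => by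
      have := hK τ W' W x x (hWR'.trans (le_max_left _ _)) (hWR.trans (le_max_left _ _)) hx hx
      rw [dist_self, zero_add, dist_comm W'] at this
      refine this.trans ?_
      gcongr
      exact_mod_cast le_self_add) t ht
  rw [h0, h0', gronwallBound_of_K_ne_0 hK1, mul_div_cancel_left₀ _ hK1] at hd
  have hexp : Real.exp ((K + 1 : ℝ≥0) * t) ≤ Real.exp ((K + 1 : ℝ≥0) * T) := by
    have := ht.2
    gcongr
  calc _ ≤ _ := hd
    _ ≤ Real.exp ((K + 1 : ℝ≥0) * t) * (dist φ φ' + dist W W') := by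
        nlinarith [dist_nonneg (x := W) (y := W')]
    _ ≤ _ := by gcongr

/-! ## Periodic distributions and the interaction picture -/

@[simp] theorem toFun_incl {r : ℝ} [Fact (1 ≤ r)] (h : r ≤ s) (f : Hs L s) :
    (incl h f).toFun = f.toFun := by
  unfold toFun
  rw [toL2_incl]

theorem fourierCoeff_toFun (f : Hs L s) (n : ℤ) : fourierCoeff f.toFun n = coeff f n := rfl

theorem fourierCoeff_nonlin (W u : Hs L s) (α : ℝ) (n : ℤ) :
    fourierCoeff (fun x => W.toFun x * u.toFun x
      + (α : ℂ) * (‖u.toFun x‖ : ℂ) ^ 2 * u.toFun x) n = coeff (nonlin W α u) n := by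
  rw [← fourierCoeff_toC]
  refine congrFun (fourierCoeff_congr_ae ?_) n
  filter_upwards [toC_ae_eq W, toC_ae_eq u] with x h1 h2
  rw [← h1, ← h2, nonlin, toC_add, toC_smul, toC_mul, toC_mul, toC_mul, toC_star]
  simp only [ContinuousMap.add_apply, ContinuousMap.mul_apply, ContinuousMap.smul_apply,
    ContinuousMap.star_apply, RCLike.star_def, smul_eq_mul, Complex.mul_conj']
  ring

theorem isNLSSolutionOn_free {hs : 1 ≤ s} {W : Hs L s} {α T : ℝ} {v : ℝ → Hs L 1}
    (hv : IsODESolution (field (incl hs W) α) T v) :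
    IsNLSSolutionOn W α (v 0) T fun t => free t (v t) := by
  refine ⟨continuousOn_free continuousOn_id hv.continuousOn, free_zero _, fun t ht n => ?_⟩
  have h1 := (hasDerivAt_phase L t n).mul
    (((coeffL (L := L) (s := 1) n).restrictScalars ℝ).hasFDerivAt.comp_hasDerivAt t
      (hv.hasDerivAt ht))
  refine ⟨_, h1.congr_of_eventuallyEq (Eventually.of_forall fun τ => ?_), ?_⟩
  · change fourierCoeff (free τ (v τ)).toFun n = phase L τ n * coeff (v τ) n
    rw [fourierCoeff_toFun, coeff_free]
  · have h2 := fourierCoeff_nonlin (incl hs W) (free t (v t)) α n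
    rw [toFun_incl] at h2
    rw [h2, fourierCoeff_toFun, coeff_free]
    change Complex.I * (-Complex.I * (freq L n ^ 2 / 2) * phase L t n * coeff (v t) n +
      phase L t n * coeff (field (incl hs W) α t (v t)) n) = _
    rw [field, coeff_free, coeff_smul]
    linear_combination (-(freq L n ^ 2 / 2 * phase L t n * coeff (v t) n) -
      phase L (-t) n * phase L t n * coeff (nonlin (incl hs W) α (free t (v t))) n) *
        Complex.I_mul_I + coeff (nonlin (incl hs W) α (free t (v t))) n * phase_neg_mul L t n

theorem isODESolution_of_isNLSSolutionOn {hs : 1 ≤ s} {W : Hs L s} {α T : ℝ} {φ : Hs L 1}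
    {u : ℝ → Hs L 1} (hu : IsNLSSolutionOn W α φ T u) :
    IsODESolution (field (incl hs W) α) T fun t => free (-t) (u t) := by
  obtain ⟨hc, h0, hd⟩ := hu
  set v : ℝ → Hs L 1 := fun t => free (-t) (u t) with hv
  intro t₁ ht₁
  have hT : 0 ≤ T := ht₁.1.trans ht₁.2
  have hvc : ContinuousOn v (Icc 0 T) := continuousOn_free continuousOn_id.neg hc
  set w := ODE.picard (field (incl hs W) α) 0 (v 0) v with hw
  have hwd : ∀ t ∈ Icc 0 T, HasDerivWithinAt w (field (incl hs W) α t (v t)) (Icc 0 T) t :=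
    fun t ht => ODE.hasDerivWithinAt_picard_Icc (u := univ) ⟨le_rfl, hT⟩
      (continuous_field (incl hs W) α).continuousOn hvc (fun _ _ => mem_univ _) (v 0) ht
  have hwc : ContinuousOn w (Icc 0 T) := fun t ht => (hwd t ht).continuousWithinAt
  have heq : EqOn v w (Icc 0 T) := by
    rcases hT.eq_or_lt with h | hT
    · subst h
      intro t ht
      have : t = 0 := le_antisymm ht.2 ht.1
      rw [this, hw, ODE.picard_apply₀]
    have hder : ∀ t ∈ Ioo 0 T, ∀ n, HasDerivAt (fun τ => coeff (v τ) n)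
        (coeff (field (incl hs W) α t (v t)) n) t := by
      intro t ht n
      obtain ⟨d, hd1, hd2⟩ := hd t ht n
      have h1 := (((hasDerivAt_phase L (-t) n).scomp t (hasDerivAt_neg t)).mul hd1)
      have h2 := fourierCoeff_nonlin (incl hs W) (u t) α n
      rw [toFun_incl] at h2
      rw [h2, fourierCoeff_toFun] at hd2
      refine (h1.congr_of_eventuallyEq (Eventually.of_forall fun τ => ?_)).congr_deriv ?_
      · change coeff (free (-τ) (u τ)) n = phase L (-τ) n * coeff (u τ) n
        rw [coeff_free]
      · simp only [hv, field, free_free_neg, coeff_free, coeff_smul, fourierCoeff_toFun,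
          Function.comp_apply]
        simp only [neg_smul, one_smul]
        linear_combination (-Complex.I * phase L (-t) n) * hd2 +
          (phase L (-t) n * d) * Complex.I_mul_I
    have hconst : ∀ t ∈ Icc 0 T, ∀ n, coeff (v t - w t) n = 0 := by
      intro t ht n
      have hcc : ContinuousOn (fun τ => coeff (v τ - w τ) n) (Icc 0 T) :=
        (continuous_coeff n).comp_continuousOn (hvc.sub hwc)
      have hz : ∀ τ ∈ Ioo 0 T, HasDerivAt (fun τ => coeff (v τ - w τ) n) 0 τ := fun τ hτ => by
        have h1 := ((coeffL (L := L) (s := 1) n).restrictScalars ℝ).hasFDerivAt.comp_hasDerivAt τ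
          ((hwd τ ⟨hτ.1.le, hτ.2.le⟩).hasDerivAt (Icc_mem_nhds hτ.1 hτ.2))
        refine (((hder τ hτ n).sub h1).congr_of_eventuallyEq
          (Eventually.of_forall fun τ => ?_)).congr_deriv (sub_self _)
        exact coeff_sub _ _ _
      have hmid : T / 2 ∈ Ioo 0 T := ⟨by linarith, by linarith⟩
      have hE : EqOn (fun τ => coeff (v τ - w τ) n) (fun _ => coeff (v (T / 2) - w (T / 2)) n)
          (Ioo 0 T) := fun τ hτ =>
        isOpen_Ioo.is_const_of_deriv_eq_zero isPreconnected_Ioo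
          (fun τ hτ => (hz τ hτ).differentiableAt.differentiableWithinAt)
          (fun τ hτ => (hz τ hτ).deriv) hτ hmid
      have hE2 := hE.of_subset_closure hcc continuousOn_const Ioo_subset_Icc_self
        (by rw [closure_Ioo hT.ne])
      have h00 : coeff (v 0 - w 0) n = 0 := by
        rw [hw, ODE.picard_apply₀, sub_self, coeff_zero]
      exact (hE2 ht).trans ((hE2 ⟨le_rfl, hT.le⟩).symm.trans h00)
    exact fun t ht => sub_eq_zero.1 (ext_coeff fun n => by rw [hconst t ht n, coeff_zero])
  exact (hwd t₁ ht₁).congr heq (heq ht₁)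

end Hs

theorem stronglyMeasurable_comp_of_continuous_subtype {Ω E F : Type*} [MeasurableSpace Ω]
    [MetricSpace E] [SecondCountableTopology E] [MetricSpace F] {p : E → Prop} {V : Ω → E}
    (hV : StronglyMeasurable V) (hp : ∀ ξ, p (V ξ)) {g : E → F}
    (hg : Continuous fun W : {W : E // p W} => g W.1) : StronglyMeasurable fun ξ => g (V ξ) := by
  borelize E
  have h : Measurable fun ξ => (⟨V ξ, hp ξ⟩ : {W : E // p W}) := hV.measurable.subtype_mk
  exact hg.comp_stronglyMeasurable h.stronglyMeasurable

namespace Hs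

variable {L s : ℝ} [Fact (0 < 2 * L)] [Fact (1 ≤ s)]

/-! ## Well-posedness and regularity of the solution -/

theorem nlsGloballyWellPosed (hs : 1 ≤ s) {W : Hs L s} (hW : star W = W) (α : ℝ) :
    NLSGloballyWellPosed W α := by
  have hW' : star (incl hs W) = incl hs W := by rw [← incl_star, hW]
  refine ⟨fun φ t => free t (flow (incl hs W) α φ t), fun φ T _ => ?_, fun φ T hT u hu t ht => ?_,
    fun φ T hT => ?_⟩
  · obtain ⟨h0, h⟩ := flow_spec hW' α φ
    have := isNLSSolutionOn_free (h T)
    rwa [h0] at this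
  · obtain ⟨h0, h⟩ := flow_spec hW' α φ
    have h1 := isODESolution_of_isNLSSolutionOn (hs := hs) hu
    have h2 := h1.eqOn (field_lipschitzOnWith _ α) (h T) (by
      rw [h0, neg_zero, free_zero]
      exact hu.2.1) ht
    change u t = free t (flow (incl hs W) α φ t)
    rw [← h2, free_free_neg]
  · obtain ⟨C, hC0, hC⟩ := exists_flow_lipschitz L 1 α (max ‖incl hs W‖ (‖φ‖ + 1)) T
    rw [Metric.tendstoUniformlyOn_iff]
    intro ε hε
    have hδ : 0 < min 1 (ε / (C + 1)) := by positivity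
    filter_upwards [Metric.ball_mem_nhds φ hδ] with φ' hφ' t ht
    rw [Metric.mem_ball, dist_comm] at hφ'
    have hn : ‖φ'‖ ≤ ‖φ‖ + 1 := by
      have h1 := norm_le_norm_add_norm_sub φ φ'
      have h2 := hφ'.trans_le (min_le_left _ _)
      rw [dist_eq_norm] at h2
      linarith
    have h := hC (incl hs W) (incl hs W) φ φ' hW' hW' (le_max_left _ _) (le_max_left _ _)
      ((le_add_of_nonneg_right zero_le_one).trans (le_max_right _ _))
      (hn.trans (le_max_right _ _)) t ht
    rw [(free t).dist_map]
    rw [dist_self, add_zero] at h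
    have h3 := hφ'.trans_le (min_le_right _ _)
    rw [lt_div_iff₀ (by positivity)] at h3
    nlinarith [dist_nonneg (x := φ) (y := φ')]

theorem continuous_flow_potential (α : ℝ) (φ : Hs L s) {t : ℝ} (ht : 0 ≤ t) :
    Continuous fun W : {W : Hs L s // star W = W} => flow W.1 α φ t := by
  rw [Metric.continuous_iff]
  intro W ε hε
  obtain ⟨C, hC0, hC⟩ := exists_flow_lipschitz L s α (max ‖φ‖ (‖W.1‖ + 1)) t
  refine ⟨min 1 (ε / (C + 1)), by positivity, fun W' hW' => ?_⟩
  rw [Subtype.dist_eq] at hW'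
  have hn : ‖W'.1‖ ≤ ‖W.1‖ + 1 := by
    have h1 := norm_le_norm_add_norm_sub' W'.1 W.1
    have h2 := hW'.trans_le (min_le_left _ _)
    rw [dist_eq_norm] at h2
    linarith
  have h := hC W'.1 W.1 φ φ W'.2 W.2 (hn.trans (le_max_right _ _))
    ((le_add_of_nonneg_right zero_le_one).trans (le_max_right _ _))
    (le_max_left _ _) (le_max_left _ _) t ⟨ht, le_rfl⟩
  rw [dist_self, zero_add] at h
  have h3 := hW'.trans_le (min_le_right _ _)
  rw [lt_div_iff₀ (by positivity)] at h3
  nlinarith [dist_nonneg (x := W'.1) (y := W.1)]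

theorem stronglyMeasurable_flow {Ω : Type*} [MeasurableSpace Ω] {V : Ω → Hs L s}
    (hV : StronglyMeasurable V) (hreal : ∀ ξ, star (V ξ) = V ξ) (α : ℝ) (φ : Hs L s) {t : ℝ}
    (ht : 0 ≤ t) : StronglyMeasurable fun ξ => flow (V ξ) α φ t :=
  stronglyMeasurable_comp_of_continuous_subtype (g := fun W => flow W α φ t) hV hreal
    (continuous_flow_potential α φ ht)

end Hs

theorem IsRandomPotential.star_eq {L s : ℝ} [Fact (0 < 2 * L)] [Fact (1 ≤ s)] {v₀ : Hs L s}
    {v : ℕ → Hs L s} {lam : ℕ → ℝ} {V : ParamSpace → Hs L s} (h : IsRandomPotential v₀ v lam V)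
    (ξ : ParamSpace) : star (V ξ) = V ξ := by
  set S : ℕ → Hs L s := fun m =>
    v₀ + ∑ j ∈ Finset.range m, ((√(lam j) * (ξ j : ℝ) : ℝ) : ℂ) • v j with hS
  have hreal : ∀ m, star (S m) = S m := fun m => by
    rw [hS]
    simp only [star_add, star_sum, star_smul, h.real_zero.star_eq, (h.real _).star_eq,
      RCLike.star_def, Complex.conj_ofReal]
  have hlim : ∀ n, Tendsto (fun m => Hs.coeff (S m) n) atTop (𝓝 (Hs.coeff (V ξ) n)) := fun n => by
    have hc : Continuous fun f : L2Torus L => fourierBasis.repr f n :=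
      (continuous_apply n).comp ((lp.uniformContinuous_coe
        (E := fun _ : ℤ => ℂ) (p := 2)).continuous.comp fourierBasis.repr.continuous)
    simp only [Hs.coeff_eq_repr]
    exact (hc.tendsto _).comp (h.series ξ)
  refine Hs.star_eq_self_iff.2 fun n => ?_
  refine tendsto_nhds_unique ?_ (hlim n)
  refine ((Complex.continuous_conj.tendsto _).comp (hlim (-n))).congr fun m => ?_
  exact Hs.star_eq_self_iff.1 (hreal m) n

end

theorem mainTheorem6 (L : ℝ) [Fact (0 < 2 * L)] (s : ℝ) (hs : 1 ≤ s) (α : ℝ) (hα : α ≠ 0)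
    (v₀ : Hs L s) (v : ℕ → Hs L s) (lam : ℕ → ℝ) (V : ParamSpace → Hs L s)
    (hV : IsRandomPotential v₀ v lam V) (ψin : Hs L s) :
    (∀ ξ : ParamSpace, NLSGloballyWellPosed (V ξ) α) ∧
    ∃ ψ : ℝ → ParamSpace → Hs L s,
      (∀ ξ : ParamSpace,
        IsNLSGlobalSolution (V ξ) α (ψin.incl hs) (fun t => (ψ t ξ).incl hs)) ∧
      (∃ C : ℝ, ∀ t : ℝ, 0 ≤ t → ∀ ξ : ParamSpace, ‖(ψ t ξ).incl hs‖ ≤ C) ∧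
      (∀ T : ℝ, 0 < T →
        MemBochnerLinfty (fun p : Ioo (0 : ℝ) T × ParamSpace => ψ p.1 p.2)) := by
  have : Fact (1 ≤ s) := ⟨hs⟩
  have hreal := hV.star_eq
  obtain ⟨hmeas, CV, hCV⟩ := hV.bounded
  have hflow := fun ξ => Hs.flow_spec (hreal ξ) α ψin
  have hreal1 : ∀ ξ, star (Hs.incl hs (V ξ)) = Hs.incl hs (V ξ) := fun ξ => by
    rw [← Hs.incl_star, hreal]
  refine ⟨fun ξ => Hs.nlsGloballyWellPosed hs (hreal ξ) α,
    fun t ξ => Hs.free t (Hs.flow (V ξ) α ψin t), fun ξ T _ => ?_, ?_, fun T hT => ⟨?_, ?_⟩⟩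
  · have h := Hs.isNLSSolutionOn_free (((hflow ξ).2 T).incl hs)
    simpa only [Hs.incl_free, (hflow ξ).1] using h
  · obtain ⟨B, hB⟩ := Hs.exists_h1_bound L α (max CV ‖ψin‖)
    refine ⟨B, fun t ht ξ => ?_⟩
    rw [Hs.incl_free, (Hs.free t).norm_map]
    refine hB (Hs.incl hs (V ξ)) (hreal1 ξ)
      ((Hs.norm_incl_le hs _).trans ((hCV ξ).trans (le_max_left _ _))) t _
      (((hflow ξ).2 t).incl hs) ?_ t ⟨ht, le_rfl⟩
    rw [(hflow ξ).1]
    exact (Hs.norm_incl_le hs _).trans (le_max_right _ _)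
  · refine stronglyMeasurable_uncurry_of_continuous_of_stronglyMeasurable
      (u := fun (t : Ioo (0 : ℝ) T) ξ => Hs.free t (Hs.flow (V ξ) α ψin t)) (fun ξ => ?_)
      fun t => ?_
    · have h := Hs.continuousOn_free continuousOn_id
        (((hflow ξ).2 T).continuousOn.mono Ioo_subset_Icc_self)
      exact continuousOn_iff_continuous_domRestrict.1 h
    · exact (Hs.free (t : ℝ)).continuous.comp_stronglyMeasurable
        (Hs.stronglyMeasurable_flow hmeas hreal α ψin t.2.1.le)
  · obtain ⟨B, hB⟩ := Hs.exists_hs_bound L s α (max CV ‖ψin‖) T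
    refine ⟨B, fun ⟨t, ξ⟩ => ?_⟩
    rw [(Hs.free (t : ℝ)).norm_map]
    refine hB (V ξ) (hreal ξ) ((hCV ξ).trans (le_max_left _ _)) T le_rfl _ ((hflow ξ).2 T) ?_ t
      ⟨t.2.1.le, t.2.2.le⟩
    rw [(hflow ξ).1]
    exact le_max_right _ _
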